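/- **Model.** There are $N$ mobile stations (MSs) $1,\dots,N$ and a base station $0$. Time is slotted. In slot $n$ the topology is $s(n)\in\mathcal S$ ($\mathcal S$ finite), i.i.d. over slots with law $(\pi_s)$; the vectors $A(n)=(A_i(n))_i$ of exogenous packet arrivals are i.i.d. over slots, bounded, independent of the topologies, with $\mathbb E[A_i(n)]=\lambda_i$. In each slot a power vector $\ell=(\ell_{ij})_{1\le i\le N,\,0\le j\le N}$ is chosen from a finite set $\mathcal L$; each MS gives power to at most one receiver (never itself), and link $(i,j)$ can then carry $\mu_{ij}(s,\ell)\in\mathbb N$ packets, with $\mu_{ij}(s,\ell)=0$ if $\ell_{ij}=0$. MS $i$ has average power budget $\overline P_i$; for each $i$, the numbers $\ell_{ij}$ and $\overline P_i$ are nonnegative integer multiples of some quantum $u_i>0$. On link $(i,0)$ either the own queue ($I_i=1$) or the relay queue ($I_i=0$) of MS $i$ is served. With $D_{ij}=\min(X_i,\mu_{ij})$ for $1\le j\le N$, $j\neq i$, $D_{i0}=I_i\min(X_i,\mu_{i0})$ and $D_{iR}=(1-I_i)\min(Y_i,\mu_{i0})$ (all in slot $n$), the own queues $X_i$, relay queues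 $Y_i$ and virtual power queues $U_i$ evolve by $$X_i(n+1)=X_i(n)-\sum_{j\ne i}D_{ij}-D_{i0}+A_i(n),\qquad Y_i(n+1)=Y_i(n)-D_{iR}+\sum_{j\neq i}D_{ji},$$ $$U_i(n+1)=\max(U_i(n)-\overline P_i,0)+\sum_{j=0,\,j\ne i}^N\ell_{ij}(n),$$ where $X_i,Y_i$ take values in $\mathbb N$ and $U_i$ in $u_i\mathbb N$. **Stabilizable.** $\lambda$ is stabilizable if there are $\delta>0$ and a (possibly randomized and history-dependent) causal scheduling policy under which, with probability one, the long-run average service rates $\overline\mu_{ij}$ of the links between MSs, $\overline\mu_{i0}$ and $\overline\mu_{iR}$ of link $(i,0)$ for the own and the relay queue, and the average powers $\overline P_i^\Delta$ exist (as constants) and satisfy, for all $i$, $$\lambda_i+\delta\le\overline\mu_{i0}+\sum_{j\ne i}\overline\mu_{ij},\qquad \sum_{j\neq i}\overline\mu_{ji}+\delta\le\overline\mu_{iR},\qquad \overline P_i^\Delta+\delta\le\overline P_i .$$ **Policy $\Delta^T_{IID}$** ($T\ge1$). In each slot $n\in[KT,(K+1)T-1]$ it uses a power vector $\ell\in\mathcal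 L$ that maximizes $$\sum_{i}\Big[\sum_{j\ne i}\big(X_i(KT)-Y_j(KT)\big)\mu_{ij}(s(n),\ell)+\max\big(X_i(KT),Y_i(KT)\big)\mu_{i0}(s(n),\ell)-U_i(KT)\sum_{j=0,j\ne i}^N\ell_{ij}\Big],$$ and on link $(i,0)$ it serves the own queue if $X_i(KT)>Y_i(KT)$ and the relay queue if $X_i(KT)<Y_i(KT)$. Ties are broken by an arbitrary fixed rule depending on the frozen queue state and the current topology. **Lemma 2.** Let $\lambda$ be stabilizable and $T\ge 1$. Under $\Delta^T_{IID}$ the sampled process $(X,Y,U)(KT)$, $K=0,1,2,\dots$, is a time-homogeneous Markov chain on a countable state space and is positive recurrent, with finite expected stationary queue lengths. Precisely: from every initial state a state with finite mean return time is reached in finite mean time; on every irreducible class (nonempty closed communicating set of states) all states have finite mean return time, and there is exactly one stationary distribution carried by the class; a stationary distribution exists; and under every stationary distribution $\mathbb E[X_i]$, $\mathbb E[Y_i]$ and $\mathbb E[U_i]$ are finite for each $i$. -/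

import Mathlib

open MeasureTheory ProbabilityTheory Filter Topology
open scoped ENNReal

noncomputable section

namespace Relay

/-! ### The network -/

/-- A cellular network with `N` mobile stations, a set `S` of topologies and a set `K` indexing the
available power vectors.  A receiver is an element of `Option (Fin N)`: `none` is the base station,
`some j` is the station `j`.

The power which station `i` spends on the link to `r` under the power vector `k` is
`unit i * tokens k i r`, and its average power budget is `unit i * budget i`: the power levels and
the budget of a station are integer multiples of a common quantum `unit i > 0`, so that the
virtual (token) queue takes values in a lattice. -/
structure Network (N : ℕ) (S K : Type*) where
  /-- number of packets that can be sent in one slot over the link from `i` to `r`, in topology `s`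
  under the (whole) power vector `k` -/
  rate : S → K → Fin N → Option (Fin N) → ℕ
  /-- transmit power on the link from `i` to `r`, in power quanta of station `i` -/
  tokens : K → Fin N → Option (Fin N) → ℕ
  /-- average power budget, in power quanta of station `i` -/
  budget : Fin N → ℕ
  /-- power quantum of station `i` -/
  unit : Fin N → ℝ
  unit_pos : ∀ i, 0 < unit i
  /-- nothing is sent over a link that is given no power -/
  rate_eq_zero : ∀ s k i r, tokens k i r = 0 → rate s k i r = 0
  /-- each station transmits to at most one receiver in a slot -/
  single_receiver : ∀ k i r r', tokens k i r ≠ 0 → tokens k i r' ≠ 0 → r = r'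
  /-- no station transmits to itself -/
  no_self : ∀ k i, tokens k i (some i) = 0

/-- Total transmit power of station `i` under the power vector `k` (base station link included). -/
def Network.power {N : ℕ} {S K : Type*} (net : Network N S K) (k : K) (i : Fin N) : ℝ :=
  net.unit i * ∑ r : Option (Fin N), (net.tokens k i r : ℝ)

/-- Average power budget of station `i`. -/
def Network.avgPower {N : ℕ} {S K : Type*} (net : Network N S K) (i : Fin N) : ℝ :=
  net.unit i * (net.budget i : ℝ)

/-- State of all queues: own queues `X`, relay queues `Y` (both in packets) and virtual power
queues `U` (station `i` in its power quanta, i.e. the length of the virtual queue is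
`net.unit i * U i`). -/
@[ext]
structure QState (N : ℕ) where
  X : Fin N → ℕ
  Y : Fin N → ℕ
  U : Fin N → ℕ

/-! ### The frame-based policy -/

/-- A decision rule: given a queue state and the current topology, the power vector to use and,
for each station, whether its link to the base station serves its own queue (`true`) or its
relay queue (`false`). -/
structure Rule (N : ℕ) (S K : Type*) where
  choice : QState N → S → K
  own : QState N → S → Fin N → Bool

/-- The weight of the power vector `k` in topology `s` for the queue state `q`. -/
def Network.weight {N : ℕ} {S K : Type*} (net : Network N S K) (q : QState N) (s : S) (k : K) :
    ℝ :=
  ∑ i : Fin N,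
    (∑ j : Fin N, ((q.X i : ℝ) - (q.Y j : ℝ)) * (net.rate s k i (some j) : ℝ)
      + max (q.X i : ℝ) (q.Y i : ℝ) * (net.rate s k i none : ℝ)
      - (net.unit i * (q.U i : ℝ)) * net.power k i)

/-- The rule picks a power vector of maximal weight, and lets each station serve the longer one of
its two queues on its link to the base station.  Ties are broken arbitrarily. -/
def Rule.IsMaxWeight {N : ℕ} {S K : Type*} (pol : Rule N S K) (net : Network N S K) : Prop :=
  ∀ q s, (∀ k, net.weight q s k ≤ net.weight q s (pol.choice q s)) ∧
    ∀ i, (pol.own q s i = true → q.Y i ≤ q.X i) ∧ (pol.own q s i = false → q.X i ≤ q.Y i)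

/-- One slot: current queue state `q`, power vector `k`, queue selection `own`, topology `s`,
arrivals `a`.  As each station has at most one receiver, at most one of the numbers that are
subtracted from `q.X i` is nonzero. -/
def Network.step {N : ℕ} {S K : Type*} (net : Network N S K) (q : QState N) (k : K)
    (own : Fin N → Bool) (s : S) (a : Fin N → ℕ) : QState N where
  X i := q.X i - (∑ j : Fin N, min (q.X i) (net.rate s k i (some j))
      + if own i = true then min (q.X i) (net.rate s k i none) else 0) + a i
  Y i := q.Y i - (if own i = true then 0 else min (q.Y i) (net.rate s k i none))
      + ∑ j : Fin N, min (q.X j) (net.rate s k j (some i))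
  U i := q.U i - net.budget i + ∑ r : Option (Fin N), net.tokens k i r

/-- Evolution under the frame-based version of the rule `pol` with frames of `T` slots: the first
component is the queue state in slot `n`, the second one is the queue state at the start of
the frame that contains slot `n`.  Decisions use the frozen (second) state and the current
topology. -/
def frameRun {N : ℕ} {S K : Type*} (net : Network N S K) (pol : Rule N S K) (T : ℕ)
    (s : ℕ → S) (a : ℕ → Fin N → ℕ) (z : QState N) : ℕ → QState N × QState N
  | 0 => (z, z)
  | n + 1 =>
    let c := frameRun net pol T s a z n
    let q := net.step c.1 (pol.choice c.2 (s n)) (pol.own c.2 (s n)) (s n) (a n)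
    (q, if T ∣ n + 1 then q else c.2)

/-- The sampled process `(X, Y, U)(m T)`, `m = 0, 1, 2, …`, started from `z`. -/
def sampled {Ω : Type*} {N : ℕ} {S K : Type*} (net : Network N S K) (pol : Rule N S K) (T : ℕ)
    (s : ℕ → Ω → S) (a : ℕ → Ω → Fin N → ℕ) (z : QState N) (m : ℕ) (ω : Ω) : QState N :=
  (frameRun net pol T (fun n => s n ω) (fun n => a n ω) z (m * T)).1

/-- The random input: the topologies `s n` are i.i.d. with law `π`, the arrival vectors `a n` are
i.i.d., bounded, with mean `lam`, and topologies and arrivals are independent. -/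
structure IsIIDInput {Ω : Type*} [MeasurableSpace Ω] {N : ℕ} {S : Type*} [MeasurableSpace S]
    (P : Measure Ω) (π : PMF S) (lam : Fin N → ℝ) (s : ℕ → Ω → S) (a : ℕ → Ω → Fin N → ℕ) :
    Prop where
  measurable_s : ∀ n, Measurable (s n)
  measurable_a : ∀ n, Measurable (a n)
  law_s : ∀ n, P.map (s n) = π.toMeasure
  law_a : ∀ n, P.map (a n) = P.map (a 0)
  indep_slots : iIndepFun (fun n ω => (s n ω, a n ω)) P
  indep_s_a : ∀ n, IndepFun (s n) (a n) P
  bounded : ∃ Amax : ℕ, ∀ n i, ∀ᵐ ω ∂P, a n ω i ≤ Amax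
  mean : ∀ i, ∫ ω, (a 0 ω i : ℝ) ∂P = lam i

/-! ### Stabilizable rate vectors -/

/-- `(1/n) ∑_{m < n} f m`. -/
def timeAvg (f : ℕ → ℝ) (n : ℕ) : ℝ := (∑ m ∈ Finset.range n, f m) / n

/-- A (possibly history dependent and randomized) scheduling policy for i.i.d. topologies of law `π`
is given by its topologies `s`, the chosen power vectors `k` and the queue selections
`own`; the topology of a slot is independent of everything that happened before.
The average service rates and powers are required to exist with probability one, and the
rate-stability conditions for `lam` (own queues, relay queues, power budgets) hold with a margin
`δ`. -/
structure IsRateStable {Ω : Type*} [MeasurableSpace Ω] {N : ℕ} {S K : Type*} [MeasurableSpace S]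
    [MeasurableSpace K] (net : Network N S K) (π : PMF S) (lam : Fin N → ℝ) (δ : ℝ)
    (P : Measure Ω) (s : ℕ → Ω → S) (k : ℕ → Ω → K) (own : ℕ → Ω → Fin N → Bool)
    (linkRate : Fin N → Fin N → ℝ) (ownRate relayRate pow : Fin N → ℝ) : Prop where
  measurable_s : ∀ n, Measurable (s n)
  measurable_k : ∀ n, Measurable (k n)
  measurable_own : ∀ n, Measurable (own n)
  law_s : ∀ n, P.map (s n) = π.toMeasure
  causal : ∀ n, IndepFun (s n) (fun ω (m : Fin n) => (s m ω, k m ω, own m ω)) P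
  /-- average service rate of the link from `i` to `j` -/
  link : ∀ i j, ∀ᵐ ω ∂P,
    Tendsto (timeAvg fun n => (net.rate (s n ω) (k n ω) i (some j) : ℝ)) atTop
      (𝓝 (linkRate i j))
  /-- average service rate of the link from `i` to the base station for the own queue -/
  own_rate : ∀ i, ∀ᵐ ω ∂P,
    Tendsto (timeAvg fun n =>
      if own n ω i = true then (net.rate (s n ω) (k n ω) i none : ℝ) else 0) atTop
      (𝓝 (ownRate i))
  /-- average service rate of the link from `i` to the base station for the relay queue -/
  relay_rate : ∀ i, ∀ᵐ ω ∂P,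
    Tendsto (timeAvg fun n =>
      if own n ω i = true then 0 else (net.rate (s n ω) (k n ω) i none : ℝ)) atTop
      (𝓝 (relayRate i))
  /-- average power of station `i` -/
  power : ∀ i, ∀ᵐ ω ∂P, Tendsto (timeAvg fun n => net.power (k n ω) i) atTop (𝓝 (pow i))
  own_stable : ∀ i, lam i + δ ≤ ownRate i + ∑ j : Fin N, linkRate i j
  relay_stable : ∀ i, ∑ j : Fin N, linkRate j i + δ ≤ relayRate i
  feasible : ∀ i, pow i + δ ≤ net.avgPower i

/-- `lam` is stabilizable: under some scheduling policy all rate-stability conditions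
hold with a positive margin. -/
def Stabilizable {N : ℕ} {S K : Type*} [MeasurableSpace S] [MeasurableSpace K]
    (net : Network N S K) (π : PMF S) (lam : Fin N → ℝ) : Prop :=
  ∃ (δ : ℝ) (Ω : Type) (_ : MeasurableSpace Ω) (P : Measure Ω) (s : ℕ → Ω → S) (k : ℕ → Ω → K)
    (own : ℕ → Ω → Fin N → Bool) (linkRate : Fin N → Fin N → ℝ)
    (ownRate relayRate pow : Fin N → ℝ),
    0 < δ ∧ IsProbabilityMeasure P ∧
      IsRateStable net π lam δ P s k own linkRate ownRate relayRate pow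

/-! ### Markov chain notions

`Z z m ω` is the position at time `m` of the chain started from `z`. -/

section Chain

variable {Ω α : Type*} [MeasurableSpace Ω]

/-- One-step transition probability. -/
def transProb (P : Measure Ω) (Z : α → ℕ → Ω → α) (z z' : α) : ℝ≥0∞ := P {ω | Z z 1 ω = z'}

/-- From each initial state, `Z` is a time-homogeneous Markov chain with these transition
probabilities. -/
def IsMarkovChain (P : Measure Ω) (Z : α → ℕ → Ω → α) : Prop :=
  ∀ z, (∀ ω, Z z 0 ω = z) ∧ ∀ (m : ℕ) (x : ℕ → α) (z' : α),
    P {ω | (∀ l ≤ m, Z z l ω = x l) ∧ Z z (m + 1) ω = z'} =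
      P {ω | ∀ l ≤ m, Z z l ω = x l} * transProb P Z (x m) z'

/-- First time at which the path `x` is in `C` (`∞` if there is none). -/
def hitTime (x : ℕ → α) (C : Set α) : ℝ≥0∞ := ⨅ (m : ℕ) (_ : x m ∈ C), (m : ℝ≥0∞)

/-- First time `m ≥ 1` at which the path `x` is at `z` (`∞` if there is none). -/
def returnTime (x : ℕ → α) (z : α) : ℝ≥0∞ := ⨅ (m : ℕ) (_ : 1 ≤ m ∧ x m = z), (m : ℝ≥0∞)

/-- The mean return time to `z` is finite. -/
def PosRecState (P : Measure Ω) (Z : α → ℕ → Ω → α) (z : α) : Prop :=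
  ∫⁻ ω, returnTime (fun m => Z z m ω) z ∂P < ∞

/-- `C` is nonempty, cannot be left, and all its states communicate: the chain restricted
to `C` is irreducible. -/
def IsIrreducibleClass (P : Measure Ω) (Z : α → ℕ → Ω → α) (C : Set α) : Prop :=
  C.Nonempty ∧ (∀ z ∈ C, ∀ z', transProb P Z z z' ≠ 0 → z' ∈ C) ∧
    ∀ z ∈ C, ∀ z' ∈ C, ∃ m, P {ω | Z z m ω = z'} ≠ 0

/-- `ν` is a stationary distribution. -/
def IsStationary (P : Measure Ω) (Z : α → ℕ → Ω → α) (ν : PMF α) : Prop :=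
  ∀ z', ν z' = ∑' z, ν z * transProb P Z z z'

end Chain

end Relay

end

/-! The engine is Foster's criterion for the Lyapunov function V = ∑ (X² + Y² + (uU)²), where u is
the power quantum of a station. Expanding the squares, V changes in one slot by at most twice
(exogenous arrivals weighted by X, minus power budgets weighted by uU, minus the gain of the
decision), plus a constant. The weights may be taken at the start of the frame, since every queue
moves by a bounded amount per slot; this costs another constant, which depends on T
(`lyapunov_frameRun_le`).

The max-weight rule is then compared with the stabilizing policy. With the queue weights frozen at
z, the gain is a fixed linear function of service rates and powers, so its time average under that
policy tends to a constant. By the rate conditions this constant exceeds the weighted arrivals minus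
budgets by δ times the total backlog of z (`IsRateStable.le_meanGain`). In each slot the mean gain
is at most the mean maximal weight, because the inequality holds pointwise and the topology has law
π; hence so is the limit (`IsRateStable.margin_le`). The mean drift over a frame is therefore at
most a constant minus 2Tδ times the backlog, and the sublevel sets of the backlog are finite.

Irreducibility is not assumed, so the Markov chain part is done by hand with Green functions of the
chain stopped on entering a set; these are least supersolutions (`green_le`). The drift gives a
finite set F reached in finite mean time from everywhere. Deleting from F the states that are not
surely the first point of F met again on their own excursions keeps the mean time finite
(`exists_thinned`). The survivors are positive recurrent, and inside an irreducible class F can be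
thinned down to any prescribed state. Normalized excursion measures give existence and uniqueness of
stationary distributions, and integrating the drift inequality bounds the mean backlog. -/

noncomputable section

namespace Relay

/-! ### Transition matrices: taboo iterates and Green functions -/

section Matrix

variable {α : Type*}

/-- Mean of `g` after one transition, on the event that this transition does not enter `C`. -/
def taboo (p : α → α → ℝ≥0∞) (C : Set α) (g : α → ℝ≥0∞) (z : α) : ℝ≥0∞ :=
  ∑' y, p z y * Cᶜ.indicator g y

/-- Mean of the sum of `g` along the path until it enters `C` at a time `≥ 1`. -/
def green (p : α → α → ℝ≥0∞) (C : Set α) (g : α → ℝ≥0∞) (z : α) : ℝ≥0∞ :=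
  ∑' m, (taboo p C)^[m] g z

/-- The set `A` cannot be left. -/
def Absorbing (p : α → α → ℝ≥0∞) (A : Set α) : Prop := ∀ z ∈ A, ∀ y, p z y ≠ 0 → y ∈ A

variable {p : α → α → ℝ≥0∞} {C D F A : Set α} {g h : α → ℝ≥0∞}

lemma taboo_le_taboo {z : α} (hgh : ∀ y, p z y ≠ 0 → Cᶜ.indicator g y ≤ Dᶜ.indicator h y) :
    taboo p C g z ≤ taboo p D h z := by
  refine ENNReal.tsum_le_tsum fun y => ?_
  by_cases hy : p z y = 0
  · simp [hy]
  · exact mul_le_mul_right (hgh y hy) _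

lemma taboo_mono (hgh : g ≤ h) : taboo p C g ≤ taboo p C h := fun _ =>
  taboo_le_taboo fun _ _ => Set.indicator_le_indicator (hgh _)

lemma taboo_anti (hCD : C ⊆ D) : taboo p D g ≤ taboo p C g := fun _ =>
  taboo_le_taboo fun _ _ =>
    Set.indicator_le_indicator_of_subset (Set.compl_subset_compl.2 hCD) (fun _ => zero_le) _

lemma taboo_add : taboo p C (g + h) = taboo p C g + taboo p C h := by
  ext z
  simp [taboo, Set.indicator_add', mul_add, ENNReal.tsum_add]

lemma taboo_mul_const (c : ℝ≥0∞) :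
    taboo p C (fun y => g y * c) = fun z => taboo p C g z * c := by
  ext z
  rw [taboo, taboo, ← ENNReal.tsum_mul_right]
  refine tsum_congr fun y => ?_
  by_cases hy : y ∈ Cᶜ <;> simp [Set.indicator, hy, mul_assoc]

lemma taboo_tsum {ι : Type*} (f : ι → α → ℝ≥0∞) :
    taboo p C (fun y => ∑' i, f i y) = fun z => ∑' i, taboo p C (f i) z := by
  ext z
  simp only [taboo]
  rw [ENNReal.tsum_comm]
  refine tsum_congr fun y => ?_
  by_cases hy : y ∈ Cᶜ <;> simp [Set.indicator, hy, ENNReal.tsum_mul_left]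

lemma taboo_iterate_tsum {ι : Type*} (m : ℕ) (f : ι → α → ℝ≥0∞) :
    (taboo p C)^[m] (fun y => ∑' i, f i y) = fun z => ∑' i, (taboo p C)^[m] (f i) z := by
  induction m generalizing f with
  | zero => rfl
  | succ m ih => simp only [Function.iterate_succ_apply, taboo_tsum, ih]

lemma taboo_iterate_mul_const (m : ℕ) (c : ℝ≥0∞) :
    (taboo p C)^[m] (fun y => g y * c) = fun z => (taboo p C)^[m] g z * c := by
  induction m generalizing g with
  | zero => rfl
  | succ m ih => simp only [Function.iterate_succ_apply, taboo_mul_const, ih]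

lemma taboo_iterate_mono (m : ℕ) (hgh : g ≤ h) : (taboo p C)^[m] g ≤ (taboo p C)^[m] h := by
  induction m generalizing g h with
  | zero => exact hgh
  | succ m ih => exact ih (taboo_mono hgh)

lemma taboo_iterate_eq_zero (hA : Absorbing p A) (hg : ∀ y ∈ A, g y = 0) (m : ℕ) :
    ∀ z ∈ A, (taboo p C)^[m] g z = 0 := by
  induction m generalizing g with
  | zero => exact hg
  | succ m ih =>
    refine ih fun z hz => ENNReal.tsum_eq_zero.2 fun y => ?_
    by_cases hy : p z y = 0
    · simp [hy]
    · simp [Set.indicator, hg y (hA z hz y hy)]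

lemma green_tsum {ι : Type*} (f : ι → α → ℝ≥0∞) :
    green p C (fun y => ∑' i, f i y) = fun z => ∑' i, green p C (f i) z := by
  ext z
  simp only [green, taboo_iterate_tsum]
  exact ENNReal.tsum_comm

lemma green_mul_const (c : ℝ≥0∞) :
    green p C (fun y => g y * c) = fun z => green p C g z * c := by
  ext z
  simp only [green, taboo_iterate_mul_const, ENNReal.tsum_mul_right]

lemma green_eq_add_taboo_green (z : α) :
    green p C g z = g z + taboo p C (green p C g) z := by
  have h1 : taboo p C (green p C g) z = ∑' m, (taboo p C)^[m + 1] g z := by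
    have := congrFun (taboo_tsum (p := p) (C := C) fun m => (taboo p C)^[m] g) z
    simp only [Function.iterate_succ_apply']
    exact this
  rw [h1, green, tsum_eq_zero_add' ENNReal.summable]
  rfl

lemma green_eq_add_green_taboo (z : α) :
    green p C g z = g z + green p C (taboo p C g) z := by
  rw [green, tsum_eq_zero_add' ENNReal.summable]
  rfl

/-- Minimality: unrolling the supersolution inequality n times bounds the n-th partial sum by `h`.
All comparisons of mean hitting times below reduce to exhibiting a supersolution. -/
lemma green_le (hgh : ∀ z, g z + taboo p C h z ≤ h z) : green p C g ≤ h := by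
  intro z
  refine ENNReal.tsum_le_of_sum_range_le fun n => ?_
  induction n generalizing z with
  | zero => simp
  | succ n ih =>
    rw [Finset.sum_range_succ']
    have key : ∑ m ∈ Finset.range n, (taboo p C)^[m + 1] g z =
        taboo p C (fun y => ∑ m ∈ Finset.range n, (taboo p C)^[m] g y) z := by
      simp only [Function.iterate_succ_apply']
      simp only [taboo]
      rw [← Summable.tsum_finsetSum fun _ _ => ENNReal.summable]
      refine tsum_congr fun y => ?_
      by_cases hy : y ∈ Cᶜ <;> simp [Set.indicator, hy, Finset.mul_sum]
    rw [key, add_comm]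
    exact (add_le_add le_rfl (taboo_mono ih z)).trans (hgh z)

lemma green_anti (hCD : C ⊆ D) : green p D g ≤ green p C g :=
  green_le fun z => by
    rw [green_eq_add_taboo_green z]
    exact add_le_add le_rfl (taboo_anti hCD z)

/-- Only states of `A` are ever visited, so it matters only that `C` catches every entrance to `D`
there. The supersolution takes the value ∞ off `A`, where nothing is claimed. -/
lemma green_le_of_absorbing (hA : Absorbing p A)
    (hle : ∀ z ∈ A, ∀ y, p z y ≠ 0 → y ∉ C → y ∉ D) :
    ∀ z ∈ A, green p C g z ≤ green p D g z := by
  classical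
  have : green p C g ≤ fun z => if z ∈ A then green p D g z else ∞ := by
    refine green_le fun z => ?_
    by_cases hz : z ∈ A
    · simp only [hz, if_true]
      rw [green_eq_add_taboo_green (C := D)]
      refine add_le_add le_rfl (taboo_le_taboo fun y hy => ?_)
      by_cases hyC : y ∈ C
      · simp [hyC]
      · simp [hyC, hle z hz y hy hyC, hA z hz y hy]
    · simp [hz]
  intro z hz
  simpa [hz] using this z

/-- No mass is lost when `C` is never met, so every term of the series is 1. -/
lemma green_one_eq_top_of_disjoint (hp : ∀ z, ∑' y, p z y = 1) (hA : Absorbing p A)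
    (hAC : ∀ y ∈ A, y ∉ C) {z : α} (hz : z ∈ A) : green p C 1 z = ∞ := by
  have : ∀ m, ∀ z ∈ A, (taboo p C)^[m] 1 z = 1 := by
    intro m
    induction m with
    | zero => simp
    | succ m ih =>
      intro z hz
      rw [Function.iterate_succ_apply', taboo, ← hp z]
      refine tsum_congr fun y => ?_
      by_cases hy : p z y = 0
      · simp [hy]
      · have := hA z hz y hy
        simp [hAC y this, ih y this]
  simp [green, this _ z hz]

/-! ### Removing states from a positive recurrent set -/

/-- Probability that the first entrance to `F` (at a time `≥ 1`) is at `x`. -/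
def entrance (p : α → α → ℝ≥0∞) (F : Set α) (x : α) : α → ℝ≥0∞ := green p F fun y => p y x

lemma taboo_diff_singleton {x : α} (hx : x ∈ F) (z : α) :
    taboo p (F \ {x}) g z = p z x * g x + taboo p F g z := by
  classical
  have hsum : p z x * g x = ∑' y, if y = x then p z x * g x else 0 := by
    rw [tsum_ite_eq]
  rw [taboo, taboo, hsum, ← ENNReal.tsum_add]
  refine tsum_congr fun y => ?_
  by_cases hy : y = x
  · subst hy; simp [hx]
  · by_cases hyF : y ∈ F <;> simp [hy, hyF]

lemma entrance_le_one (hp : ∀ z, ∑' y, p z y = 1) {x : α} (hx : x ∈ F) :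
    entrance p F x ≤ 1 := by
  refine green_le fun z => ?_
  have := taboo_diff_singleton (p := p) (g := 1) hx z
  simp only [Pi.one_apply, mul_one] at this
  rw [← this]
  calc taboo p (F \ {x}) 1 z ≤ taboo p ∅ 1 z := taboo_anti (Set.empty_subset _) z
    _ = 1 := by simp [taboo, hp]

/-- A renewal argument: entrances to `F` that occur at `x` are ignored and the path restarts from
`x`. The number of restarts is geometric with ratio `entrance p F x x < 1`, so the mean time stays
finite. -/
lemma green_diff_singleton_lt_top (hp : ∀ z, ∑' y, p z y = 1) (hF : ∀ z ∈ A, green p F 1 z < ∞)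
    {x : α} (hx : x ∈ F) (hxA : x ∈ A) (hq : entrance p F x x ≠ 1) :
    ∀ z ∈ A, green p (F \ {x}) 1 z < ∞ := by
  set q := entrance p F x with hqdef
  have hq1 : q x < 1 := lt_of_le_of_ne (entrance_le_one hp hx x) hq
  set t := green p F 1 x / (1 - q x) with ht
  have h0 : 1 - q x ≠ 0 := (tsub_pos_of_lt hq1).ne'
  have htop : 1 - q x ≠ ∞ := ENNReal.sub_ne_top ENNReal.one_ne_top
  have ht_top : t < ∞ := ENNReal.div_lt_top (hF x hxA).ne h0
  -- `t` solves `t = green p F 1 x + q x * t`: it is the mean time from `x` until `F \ {x}` if each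
  -- return to `x` starts afresh.
  have hgx : green p F 1 x + q x * t = t := by
    have : green p F 1 x = (1 - q x) * t := (ENNReal.mul_div_cancel h0 htop).symm
    rw [this, ← add_mul, tsub_add_cancel_of_le hq1.le, one_mul]
  have key : green p (F \ {x}) 1 ≤ green p F 1 + fun z => q z * t := by
    refine green_le fun z => le_of_eq ?_
    rw [taboo_diff_singleton hx, taboo_add, taboo_mul_const]
    simp only [Pi.add_apply, hgx]
    conv_rhs => rw [green_eq_add_taboo_green z, hqdef, entrance, green_eq_add_taboo_green z]
    simp only [hqdef, entrance]
    ring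
  intro z hz
  refine (key z).trans_lt ?_
  exact ENNReal.add_lt_top.2 ⟨hF z hz, ENNReal.mul_lt_top
    ((entrance_le_one hp hx z).trans_lt ENNReal.one_lt_top) ht_top⟩

/-- The entrance probability, set to 1 at `x` and to 0 on the rest of `F`, is at most 1. If its
average over one transition is 1, it equals 1 at every state that the transition can reach. -/
lemma mem_of_entrance_eq_one (hp : ∀ z, ∑' y, p z y = 1) {x z y : α} (hx : x ∈ F)
    (hz : entrance p F x z = 1) (hy : p z y ≠ 0) : y = x ∨ (y ∉ F ∧ entrance p F x y = 1) := by
  classical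
  by_contra hcon
  push Not at hcon
  have hle := entrance_le_one hp hx
  set w : α → ℝ≥0∞ := fun y => if y = x then 1 else entrance p F x y with hw
  have hw1 : ∀ y, w y ≤ 1 := fun y => by
    by_cases h : y = x
    · simp [hw, h]
    · simpa [hw, h] using hle y
  have h1 : taboo p (F \ {x}) w z = 1 := by
    rw [taboo_diff_singleton hx, ← hz, entrance, green_eq_add_taboo_green z]
    simp only [hw, if_true, mul_one]
    congr 1
    refine le_antisymm (taboo_le_taboo fun y _ => ?_) (taboo_le_taboo fun y _ => ?_) <;>
    · by_cases hyF : y ∈ F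
      · simp [hyF]
      · have : y ≠ x := fun h => hyF (h ▸ hx)
        simp [hyF, this, entrance]
  have hp_top : p z y ≠ ∞ :=
    ((ENNReal.le_tsum y).trans_lt ((hp z).trans_lt ENNReal.one_lt_top)).ne
  have hlt : taboo p (F \ {x}) w z < ∑' y, p z y := by
    refine ENNReal.tsum_lt_tsum (i := y) (by rw [taboo] at h1; rw [h1]; simp) (fun y => ?_) ?_
    · refine (mul_le_mul_right (b := _) (c := 1) ?_ _).trans_eq (mul_one _)
      exact Set.indicator_apply_le' (fun _ => hw1 y) fun _ => zero_le_one
    · have : (F \ {x})ᶜ.indicator w y < 1 := by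
        by_cases hyF : y ∈ F
        · simp [hyF, hcon.1]
        · have := lt_of_le_of_ne (hle y) (hcon.2 hyF)
          simpa [hyF, hw, hcon.1] using this
      calc _ < p z y * 1 := ENNReal.mul_lt_mul_right hy hp_top this
        _ = p z y := mul_one _
  rw [h1, hp z] at hlt
  exact lt_irrefl _ hlt

lemma absorbing_of_entrance_eq_one (hp : ∀ z, ∑' y, p z y = 1) {x : α} (hx : x ∈ F)
    (hq : entrance p F x x = 1) : Absorbing p {y | y = x ∨ (y ∉ F ∧ entrance p F x y = 1)} := by
  rintro z (rfl | ⟨-, hz⟩) y hy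
  · exact mem_of_entrance_eq_one hp hx hq hy
  · exact mem_of_entrance_eq_one hp hx hz hy

/-- A path from `x` stays in the absorbing set on which the only point of `F` is `x`, so stopping at
`F` and stopping at `x` coincide. -/
lemma green_singleton_le (hp : ∀ z, ∑' y, p z y = 1) {x : α} (hx : x ∈ F)
    (hq : entrance p F x x = 1) : green p {x} g x ≤ green p F g x := by
  refine green_le_of_absorbing (absorbing_of_entrance_eq_one hp hx hq) ?_ x (Or.inl rfl)
  intro z hz y hy hyx
  rcases absorbing_of_entrance_eq_one hp hx hq z hz y hy with h | h
  · exact absurd h hyx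
  · exact h.1

/-- A finite set which is reached in finite mean time from an absorbing set `A` can be thinned out,
keeping the states in `D`, until the other remaining states lie in `A` and the path started from
any one of them comes back to it before it visits the rest. -/
lemma exists_thinned (hp : ∀ z, ∑' y, p z y = 1) (hA : Absorbing p A) (D : Set α) (F : Finset α)
    (hF : ∀ z ∈ A, green p F 1 z < ∞) :
    ∃ F' : Finset α, (∀ z ∈ A, green p F' 1 z < ∞) ∧ (∀ x ∈ F, x ∈ D → x ∈ F') ∧
      ∀ x ∈ F', x ∉ D → x ∈ A ∧ entrance p F' x x = 1 := by
  classical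
  induction F using Finset.strongInduction with
  | H F ih =>
    by_cases hgood : ∀ x ∈ F, x ∉ D → x ∈ A ∧ entrance p F x x = 1
    · exact ⟨F, hF, fun x hx _ => hx, hgood⟩
    · push Not at hgood
      obtain ⟨x, hxF, hxD, hx⟩ := hgood
      -- A bad state can be dropped: inside `A` by the renewal argument, outside `A` because no path
      -- from `A` visits it.
      have hlt : ∀ z ∈ A, green p (F.erase x) 1 z < ∞ := by
        rw [Finset.coe_erase]
        by_cases hxA : x ∈ A
        · exact green_diff_singleton_lt_top hp hF hxF hxA (hx hxA)
        · intro z hz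
          refine (green_le_of_absorbing hA ?_ z hz).trans_lt (hF z hz)
          intro z hz y hy hyF hyF'
          have : y ≠ x := fun h => hxA (h ▸ hA z hz y hy)
          exact hyF ⟨hyF', this⟩
      obtain ⟨F', h1, h2, h3⟩ := ih _ (Finset.erase_ssubset hxF) hlt
      exact ⟨F', h1, fun y hy hyD =>
        h2 y (Finset.mem_erase.2 ⟨fun h => hxD (h ▸ hyD), hy⟩) hyD, h3⟩

/-- Positive recurrent states are reached in finite mean time if some finite set is. -/
lemma green_posRec_lt_top (hp : ∀ z, ∑' y, p z y = 1) (F : Finset α)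
    (hF : ∀ z, green p F 1 z < ∞) (z : α) : green p {x | green p {x} 1 x < ∞} 1 z < ∞ := by
  obtain ⟨F', h1, -, h3⟩ := exists_thinned (A := Set.univ) hp (fun _ _ _ _ => trivial) ∅ F
    fun z _ => hF z
  refine (green_anti ?_ z).trans_lt (h1 z trivial)
  intro x hx
  exact (green_singleton_le hp hx (h3 x hx (by simp)).2).trans_lt (h1 x trivial)

/-- Within an irreducible class, each state is reached in finite mean time if some finite set is. -/
lemma green_singleton_lt_top (hp : ∀ z, ∑' y, p z y = 1) (F : Finset α)
    (hF : ∀ z, green p F 1 z < ∞) (hA : Absorbing p A) {z : α}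
    (hcom : ∀ x ∈ A, ∃ m, (taboo p ∅)^[m] (({z} : Set α).indicator 1) x ≠ 0) :
    ∀ y ∈ A, green p {z} 1 y < ∞ := by
  classical
  -- The thinning protects `z`. Another survivor `x` would span an absorbing set that avoids `z`,
  -- although `z` can be reached from `x`.
  obtain ⟨F', h1, h2, h3⟩ := exists_thinned hp hA {z} (insert z F) fun y _ =>
    (green_anti (by simp) y).trans_lt (hF y)
  have hz : z ∈ F' := h2 z (by simp) rfl
  have : F' = {z} := by
    refine Finset.eq_singleton_iff_unique_mem.2 ⟨hz, fun x hx => ?_⟩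
    by_contra hxz
    obtain ⟨hxA, hq⟩ := h3 x hx hxz
    obtain ⟨m, hm⟩ := hcom x hxA
    refine hm (taboo_iterate_eq_zero
      (absorbing_of_entrance_eq_one (F := (F' : Set α)) hp hx hq) ?_ m x (Or.inl rfl))
    rintro y (rfl | ⟨hy, -⟩)
    · simp [hxz]
    · have : y ≠ z := fun h => hy (h ▸ hz)
      simp [this]
  simpa [this] using h1

/-! ### Foster's criterion -/

/-- If `V` has drift `≤ b - f`, then the set `{f ≤ b + 1}` is reached in finite mean time. -/
lemma green_lt_top_of_drift {V f : α → ℝ≥0∞} {b : ℝ≥0∞} (hb : b ≠ ∞) (hV : ∀ z, V z ≠ ∞)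
    (hdrift : ∀ z, taboo p ∅ V z + f z ≤ V z + b) (hF : ∀ z, z ∉ F → b + 1 ≤ f z) (z : α) :
    green p F 1 z < ∞ := by
  classical
  -- Off `F` the drift of `V` is at most -1, so `V` itself is a supersolution there; the extra `b +
  -- 1` pays for the first step from a state of `F`.
  have key : green p F 1 ≤ fun z => V z + if z ∈ F then b + 1 else 0 := by
    refine green_le fun z => ?_
    have h1 : taboo p F (fun z => V z + if z ∈ F then b + 1 else 0) z ≤ taboo p ∅ V z := by
      refine taboo_le_taboo fun y _ => ?_
      by_cases hy : y ∈ F <;> simp [hy]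
    refine (add_le_add le_rfl h1).trans ?_
    by_cases hz : z ∈ F
    · simp only [hz, if_true, Pi.one_apply]
      calc 1 + taboo p ∅ V z ≤ 1 + (taboo p ∅ V z + f z) := by gcongr; exact le_self_add
        _ ≤ 1 + (V z + b) := add_le_add le_rfl (hdrift z)
        _ = V z + (b + 1) := by ring
    · simp only [hz, if_false, Pi.one_apply, add_zero]
      have h2 : b + (1 + taboo p ∅ V z) ≤ b + V z := by
        calc b + (1 + taboo p ∅ V z) = taboo p ∅ V z + (b + 1) := by ring
          _ ≤ taboo p ∅ V z + f z := by gcongr; exact hF z hz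
          _ ≤ V z + b := hdrift z
          _ = b + V z := add_comm _ _
      exact (ENNReal.add_le_add_iff_left hb).1 h2
  refine (key z).trans_lt (ENNReal.add_lt_top.2 ⟨(hV z).lt_top, ?_⟩)
  split_ifs <;> simp [hb.lt_top]

/-! ### Stationary distributions -/

lemma tsum_mul_taboo_empty {ν : α → ℝ≥0∞} (hν : ∀ y, ν y = ∑' z, ν z * p z y) (g : α → ℝ≥0∞) :
    ∑' z, ν z * taboo p ∅ g z = ∑' y, ν y * g y := by
  simp only [taboo, Set.compl_empty, Set.indicator_univ, ← ENNReal.tsum_mul_left]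
  rw [ENNReal.tsum_comm]
  refine tsum_congr fun y => ?_
  rw [hν y, ← ENNReal.tsum_mul_right]
  exact tsum_congr fun z => by ring

/-- Under a stationary distribution the mean of `f` is at most `b` if some finite function `V` has
drift `≤ b - f`. -/
lemma tsum_mul_le_of_drift (hp : ∀ z, ∑' y, p z y = 1) {V f : α → ℝ≥0∞} {b : ℝ≥0∞}
    (hV : ∀ z, V z ≠ ∞) (hdrift : ∀ z, taboo p ∅ V z + f z ≤ V z + b) (ν : PMF α)
    (hν : ∀ y, ν y = ∑' z, ν z * p z y) : ∑' z, ν z * f z ≤ b := by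
  classical
  -- The mean of `V` under `ν` may be infinite and could not be cancelled. The truncation `min V n`
  -- has finite mean and keeps the drift inequality, with `f` cut off where `V > n`.
  have trunc : ∀ n : ℕ, ∑' z, ν z * (if V z ≤ n then f z else 0) ≤ b := by
    intro n
    set W : α → ℝ≥0∞ := fun z => min (V z) n with hW
    have h1 : ∀ z, taboo p ∅ W z + (if V z ≤ n then f z else 0) ≤ W z + b := by
      intro z
      by_cases hz : V z ≤ n
      · simp only [hz, if_true]
        calc taboo p ∅ W z + f z ≤ taboo p ∅ V z + f z := by
              gcongr; exact taboo_mono (fun _ => min_le_left _ _) z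
          _ ≤ V z + b := hdrift z
          _ = W z + b := by simp [hW, hz]
      · simp only [hz, if_false, add_zero]
        calc taboo p ∅ W z ≤ taboo p ∅ (fun _ => (1 : ℝ≥0∞) * n) z :=
              taboo_mono (fun _ => by simp [hW]) z
          _ = n := by rw [taboo_mul_const]; simp [taboo, hp]
          _ = W z := by simp [hW, (not_le.1 hz).le]
          _ ≤ W z + b := le_self_add
    have h2 : ∑' z, ν z * taboo p ∅ W z + ∑' z, ν z * (if V z ≤ n then f z else 0) ≤
        ∑' z, ν z * W z + b := by
      calc _ = ∑' z, ν z * (taboo p ∅ W z + (if V z ≤ n then f z else 0)) := by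
            rw [← ENNReal.tsum_add]; simp only [mul_add]
        _ ≤ ∑' z, ν z * (W z + b) := ENNReal.tsum_le_tsum fun z => mul_le_mul_right (h1 z) _
        _ = ∑' z, ν z * W z + b := by
            simp only [mul_add]
            rw [ENNReal.tsum_add, ENNReal.tsum_mul_right, ν.tsum_coe, one_mul]
    rw [tsum_mul_taboo_empty hν] at h2
    refine (ENNReal.add_le_add_iff_left (ne_of_lt ?_)).1 h2
    calc ∑' z, ν z * W z ≤ ∑' z, ν z * n :=
          ENNReal.tsum_le_tsum fun z => mul_le_mul_right (min_le_right _ _) _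
      _ = n := by rw [ENNReal.tsum_mul_right, ν.tsum_coe, one_mul]
      _ < ∞ := ENNReal.natCast_lt_top n
  rw [ENNReal.tsum_eq_iSup_sum]
  refine iSup_le fun s => ?_
  obtain ⟨n, hn⟩ := ENNReal.exists_nat_gt (ENNReal.sum_ne_top.2 fun z (_ : z ∈ s) => hV z)
  calc ∑ z ∈ s, ν z * f z = ∑ z ∈ s, ν z * (if V z ≤ n then f z else 0) := by
        refine Finset.sum_congr rfl fun z hz => ?_
        rw [if_pos ((Finset.single_le_sum (fun _ _ => zero_le) hz).trans hn.le)]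
    _ ≤ _ := ENNReal.sum_le_tsum s
    _ ≤ b := trunc n

/-! ### Excursion measures: stationarity and uniqueness -/

lemma tsum_green_indicator (z : α) :
    ∑' y, green p C (({y} : Set α).indicator 1) z = green p C 1 z := by
  classical
  rw [← congrFun (green_tsum (p := p) (C := C) fun y : α => ({y} : Set α).indicator 1) z]
  congr 1
  ext w
  simp [Set.indicator]

/-- Expected number of visits to `y` on an excursion from `z`, normalized. -/
def excursionPMF (z : α) (hz : green p {z} 1 z < ∞) : PMF α :=
  ⟨fun y => green p {z} (({y} : Set α).indicator 1) z * (green p {z} 1 z)⁻¹, by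
    have h0 : green p {z} 1 z ≠ 0 := by
      rw [green_eq_add_taboo_green]
      simp
    have := ENNReal.summable.hasSum
      (f := fun y => green p {z} (({y} : Set α).indicator 1) z * (green p {z} 1 z)⁻¹)
    rwa [ENNReal.tsum_mul_right, tsum_green_indicator, ENNReal.mul_inv_cancel h0 hz.ne] at this⟩

lemma excursionPMF_apply (z : α) (hz : green p {z} 1 z < ∞) (y : α) :
    excursionPMF z hz y = green p {z} (({y} : Set α).indicator 1) z * (green p {z} 1 z)⁻¹ := rfl

/-- Each step either enters `z` or avoids it. Summing this along an excursion and cancelling the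
finite mean length leaves total entrance probability 1. -/
lemma entrance_self_of_green_lt_top (hp : ∀ z, ∑' y, p z y = 1) {z : α}
    (hz : green p {z} 1 z < ∞) : entrance p {z} z z = 1 := by
  have h1 : (1 : α → ℝ≥0∞) = (fun y => p y z) + taboo p {z} 1 := by
    ext y
    have := taboo_diff_singleton (p := p) (F := {z}) (x := z) (g := 1) rfl y
    simp only [sdiff_self, Set.bot_eq_empty, Pi.one_apply, mul_one] at this
    rw [Pi.add_apply, ← this]
    simp [taboo, hp]
  have h2 : green p {z} 1 z = entrance p {z} z z + green p {z} (taboo p {z} 1) z := by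
    have := congrFun (green_tsum (p := p) (C := {z})
      fun b : Bool => if b then (fun y => p y z) else taboo p {z} 1) z
    simp only [tsum_bool, if_true, Bool.false_eq_true, if_false] at this
    rw [entrance, add_comm, ← this]
    conv_lhs => rw [h1]
    congr 1
    ext y
    simp [add_comm]
  have h3 := green_eq_add_green_taboo (p := p) (C := {z}) (g := 1) z
  have h4 : green p {z} (taboo p {z} 1) z ≠ ∞ := by
    intro h
    rw [h3, h] at hz
    simp at hz
  rw [h2] at h3
  exact (ENNReal.add_left_inj h4).1 h3

lemma taboo_indicator_of_notMem {w : α} (hw : w ∉ C) :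
    taboo p C (({w} : Set α).indicator 1) = fun y => p y w := by
  classical
  ext y
  rw [taboo, tsum_eq_single w]
  · simp [hw]
  · intro v hv
    by_cases hvC : v ∈ C <;> simp [hv, hvC]

lemma taboo_indicator_of_mem {w : α} (hw : w ∈ C) :
    taboo p C (({w} : Set α).indicator 1) = 0 := by
  ext y
  refine ENNReal.tsum_eq_zero.2 fun v => ?_
  by_cases hv : v = w
  · subst hv; simp [hw]
  · simp [Set.indicator, hv]

lemma green_indicator_self (z : α) : green p {z} (({z} : Set α).indicator 1) z = 1 := by
  rw [green_eq_add_green_taboo, taboo_indicator_of_mem (Set.mem_singleton z)]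
  have : green p {z} 0 z = 0 := ENNReal.tsum_eq_zero.2 fun m =>
    taboo_iterate_eq_zero (A := Set.univ) (fun _ _ _ _ => trivial) (fun _ _ => rfl) m z trivial
  simp [this]

/-- Moving an excursion forward by one step trades the visit to `z` at its start for the one at its
end, so the visit counts do not change. -/
lemma excursionPMF_stationary (hp : ∀ z, ∑' y, p z y = 1) (z : α) (hz : green p {z} 1 z < ∞)
    (w : α) : excursionPMF z hz w = ∑' y, excursionPMF z hz y * p y w := by
  classical
  have h1 : ∑' y, green p {z} (({y} : Set α).indicator 1) z * p y w = entrance p {z} w z := by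
    have := congrFun (green_tsum (p := p) (C := {z})
      fun y : α => fun v => ({y} : Set α).indicator 1 v * p y w) z
    simp only [green_mul_const] at this
    rw [← this, entrance]
    congr 1
    ext v
    rw [tsum_eq_single v]
    · simp
    · intro u hu
      simp [Set.indicator, hu.symm]
  have h2 : entrance p {z} w z = green p {z} (({w} : Set α).indicator 1) z := by
    by_cases hw : w = z
    · subst hw
      rw [green_indicator_self, entrance_self_of_green_lt_top hp hz]
    · rw [green_eq_add_green_taboo, taboo_indicator_of_notMem (by simpa using hw), entrance]
      simp [Set.indicator, Ne.symm hw]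
  simp only [excursionPMF_apply]
  rw [← h2, ← h1, ← ENNReal.tsum_mul_right]
  exact tsum_congr fun y => by ring

lemma excursionPMF_support_subset (hA : Absorbing p A) {z : α} (hzA : z ∈ A)
    (hz : green p {z} 1 z < ∞) : (excursionPMF z hz).support ⊆ A := by
  intro y hy
  by_contra hyA
  refine (PMF.mem_support_iff _ _).1 hy ?_
  have : green p {z} (({y} : Set α).indicator 1) z = 0 := ENNReal.tsum_eq_zero.2 fun m =>
    taboo_iterate_eq_zero hA (fun x hx => by
      have : x ≠ y := fun h => hyA (h ▸ hx)
      simp [this]) m z hzA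
  simp [excursionPMF_apply, this]

/-- A stationary distribution carried by a set from which `z` is reached in finite mean time is the
normalized excursion measure. -/
lemma eq_excursionPMF (hp : ∀ z, ∑' y, p z y = 1) {ν : PMF α}
    (hν : ∀ y, ν y = ∑' z, ν z * p z y) {z : α}
    (hz : green p {z} 1 z < ∞) (hA : ∀ y ∈ ν.support, green p {z} 1 y < ∞) :
    ν = excursionPMF z hz := by
  classical
  set K := taboo p ({z} : Set α) with hK
  have split : ∀ g : α → ℝ≥0∞, ∑' y, ν y * g y =
      ν z * g z + ∑' y, ν y * ({z} : Set α)ᶜ.indicator g y := by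
    intro g
    have hs : ν z * g z = ∑' y, if y = z then ν z * g z else 0 := by rw [tsum_ite_eq]
    rw [hs, ← ENNReal.tsum_add]
    refine tsum_congr fun y => ?_
    by_cases hy : y = z
    · subst hy; simp
    · simp [hy]
  have shift : ∀ g : α → ℝ≥0∞, ∑' y, ν y * ({z} : Set α)ᶜ.indicator g y = ∑' y, ν y * K g y := by
    intro g
    rw [← tsum_mul_taboo_empty hν]
    refine tsum_congr fun y => ?_
    simp [hK, taboo]
  -- Stationarity is iterated, splitting off at each stage the mass at `z`: the main term counts
  -- visits since the last time at `z`, the remainder is the mass that has avoided `z` for `M`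
  -- steps.
  have iter : ∀ (g : α → ℝ≥0∞) (M : ℕ), ∑' y, ν y * g y =
      ν z * ∑ m ∈ Finset.range M, K^[m] g z + ∑' y, ν y * K^[M] g y := by
    intro g M
    induction M with
    | zero => simp
    | succ M ih =>
      rw [ih, split (K^[M] g), shift, Finset.sum_range_succ, mul_add, add_assoc,
        Function.iterate_succ_apply']
  have vanish : Tendsto (fun M => ∑' y, ν y * K^[M] 1 y) atTop (𝓝 0) := by
    have hK1 : ∀ M y, K^[M] 1 y ≤ 1 := by
      intro M
      induction M with
      | zero => simp
      | succ M ih =>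
        intro y
        rw [Function.iterate_succ_apply']
        calc K (K^[M] 1) y ≤ taboo p ∅ 1 y :=
              (taboo_anti (Set.empty_subset _) y).trans (taboo_mono ih y)
          _ = 1 := by simp [taboo, hp]
    let _ : MeasurableSpace α := ⊤
    have := tendsto_lintegral_of_dominated_convergence (μ := Measure.count)
      (F := fun M y => ν y * K^[M] 1 y) (f := fun _ => 0) ν (fun _ => measurable_from_top)
      (fun M => ae_of_all _ fun y => (mul_le_mul_right (hK1 M y) _).trans_eq (mul_one _))
      (by rw [lintegral_count' measurable_from_top]; exact ν.tsum_coe_ne_top)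
      (ae_of_all _ fun y => ?_)
    · simpa only [lintegral_count' measurable_from_top, tsum_zero] using this
    · by_cases hy : y ∈ ν.support
      -- The terms of the convergent series `green p {z} 1 y` tend to 0.
      · have h0 := ENNReal.tendsto_atTop_zero_of_tsum_ne_top (hA y hy).ne
        simpa using ENNReal.Tendsto.const_mul h0 (Or.inr (ν.apply_ne_top y))
      · simp [(PMF.apply_eq_zero_iff _ _).2 hy]
  have hval : ∀ w, ν w = ν z * green p {z} (({w} : Set α).indicator 1) z := by
    intro w
    have h1 : ∑' y, ν y * ({w} : Set α).indicator 1 y = ν w := by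
      rw [tsum_eq_single w]
      · simp
      · intro v hv
        simp [hv]
    have h2 : Tendsto (fun M => ν z * ∑ m ∈ Finset.range M, K^[m] (({w} : Set α).indicator 1) z +
        ∑' y, ν y * K^[M] (({w} : Set α).indicator 1) y) atTop
        (𝓝 (ν z * green p {z} (({w} : Set α).indicator 1) z + 0)) := by
      refine Tendsto.add (ENNReal.Tendsto.const_mul (ENNReal.tendsto_nat_tsum _) (Or.inr ?_)) ?_
      · exact ν.apply_ne_top z
      · refine tendsto_of_tendsto_of_tendsto_of_le_of_le tendsto_const_nhds vanish
          (fun _ => zero_le) fun M => ENNReal.tsum_le_tsum fun y => mul_le_mul_right ?_ _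
        exact taboo_iterate_mono M (Set.indicator_le_self' fun _ _ => zero_le) y
    simp only [← iter, h1, add_zero] at h2
    exact tendsto_nhds_unique tendsto_const_nhds h2
  have hz1 : ν z * green p {z} 1 z = 1 := by
    rw [← tsum_green_indicator, ← ENNReal.tsum_mul_left, ← ν.tsum_coe]
    exact tsum_congr fun w => (hval w).symm
  ext w
  rw [excursionPMF_apply, hval w, mul_comm, ENNReal.eq_inv_of_mul_eq_one_left hz1]

end Matrix

/-! ### From paths to transition matrices -/

section Paths

variable {Ω α : Type*}

/-- The first time `≥ 1` at which a path is in `C` is the number of times up to which it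
avoids `C`. -/
lemma iInf_entrance_eq_tsum (x : ℕ → α) (C : Set α) :
    (⨅ (m : ℕ) (_ : 1 ≤ m ∧ x m ∈ C), (m : ℝ≥0∞)) =
      ∑' m : ℕ, {m : ℕ | ∀ l, 1 ≤ l → l ≤ m → x l ∉ C}.indicator (1 : ℕ → ℝ≥0∞) m := by
  classical
  by_cases hex : ∃ m, 1 ≤ m ∧ x m ∈ C
  · have hspec := Nat.find_spec hex
    have hset : {m : ℕ | ∀ l, 1 ≤ l → l ≤ m → x l ∉ C} = Finset.range (Nat.find hex) := by
      ext m
      simp only [Set.mem_ofPred_eq, Finset.coe_range, Set.mem_Iio]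
      constructor
      · intro h
        by_contra hm
        exact h _ hspec.1 (not_lt.1 hm) hspec.2
      · intro h l h1 hl hx
        exact Nat.find_min hex (hl.trans_lt h) ⟨h1, hx⟩
    rw [hset, ← sum_eq_tsum_indicator]
    simp only [Pi.one_apply, Finset.sum_const, Finset.card_range, nsmul_eq_mul, mul_one]
    refine le_antisymm (iInf₂_le_of_le _ hspec le_rfl) (le_iInf₂ fun m hm => ?_)
    exact_mod_cast Nat.find_min' hex hm
  · push Not at hex
    have hset : {m : ℕ | ∀ l, 1 ≤ l → l ≤ m → x l ∉ C} = Set.univ :=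
      Set.eq_univ_of_forall fun m l h1 _ => hex l h1
    rw [hset]
    simp only [Set.indicator_univ, Pi.one_apply, ENNReal.tsum_one]
    simp only [ENat.card_eq_top_of_infinite, ENat.toENNReal_top]
    exact iInf₂_eq_top.2 fun m hm => absurd hm.2 (hex m hm.1)

variable [MeasurableSpace Ω]

/-- From each initial state, `Z` is adapted to `ℱ` and is a Markov chain with transition matrix `p`
with respect to `ℱ`. -/
structure IsAdaptedChain (P : Measure Ω) (ℱ : ℕ → MeasurableSpace Ω) (Z : α → ℕ → Ω → α)
    (p : α → α → ℝ≥0∞) : Prop where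
  zero : ∀ z ω, Z z 0 ω = z
  le : ∀ m, ℱ m ≤ ‹MeasurableSpace Ω›
  adapted : ∀ z m l, l ≤ m → ∀ B : Set α, MeasurableSet[ℱ m] {ω | Z z l ω ∈ B}
  markov : ∀ z m E, MeasurableSet[ℱ m] E → ∀ x y,
    P (E ∩ {ω | Z z m ω = x} ∩ {ω | Z z (m + 1) ω = y}) = P (E ∩ {ω | Z z m ω = x}) * p x y

lemma setLIntegral_countable_comp [Countable α] {P : Measure Ω} {W : Ω → α}
    (hW : ∀ B : Set α, MeasurableSet {ω | W ω ∈ B}) (E : Set Ω)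
    (g : α → ℝ≥0∞) : ∫⁻ ω in E, g (W ω) ∂P = ∑' x, P (E ∩ {ω | W ω = x}) * g x := by
  let _ : MeasurableSpace α := ⊤
  have hWm : Measurable W := fun B _ => hW B
  rw [← lintegral_map measurable_from_top hWm, lintegral_countable']
  refine tsum_congr fun x => ?_
  rw [Measure.map_apply hWm (measurableSet_singleton x),
    Measure.restrict_apply (hWm (measurableSet_singleton x)), mul_comm, Set.inter_comm]
  rfl

namespace IsAdaptedChain

variable {P : Measure Ω} {ℱ : ℕ → MeasurableSpace Ω} {Z : α → ℕ → Ω → α} {p : α → α → ℝ≥0∞}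

lemma measurableSet (hZ : IsAdaptedChain P ℱ Z p) (z : α) (m : ℕ) (B : Set α) :
    MeasurableSet {ω | Z z m ω ∈ B} :=
  hZ.le m _ (hZ.adapted z m m le_rfl B)

lemma setLIntegral_succ [Countable α] (hZ : IsAdaptedChain P ℱ Z p) (z : α) (m : ℕ) (C : Set α)
    (g : α → ℝ≥0∞) {E : Set Ω} (hE : MeasurableSet[ℱ m] E) :
    ∫⁻ ω in E, Cᶜ.indicator g (Z z (m + 1) ω) ∂P = ∫⁻ ω in E, taboo p C g (Z z m ω) ∂P := by
  rw [setLIntegral_countable_comp (hZ.measurableSet z (m + 1)),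
    setLIntegral_countable_comp (hZ.measurableSet z m)]
  have h1 : ∀ y, P (E ∩ {ω | Z z (m + 1) ω = y}) =
      ∑' x, P (E ∩ {ω | Z z m ω = x}) * p x y := by
    intro y
    have h2 := setLIntegral_countable_comp (P := P) (hZ.measurableSet z m)
      (E ∩ {ω | Z z (m + 1) ω ∈ ({y} : Set α)}) 1
    simp only [Pi.one_apply, lintegral_const, MeasurableSet.univ, Measure.restrict_apply,
      Set.univ_inter, one_mul, mul_one] at h2
    refine h2.trans (tsum_congr fun x => ?_)
    rw [← hZ.markov z m E hE x y]
    congr 1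
    ext ω
    simp only [Set.mem_inter_iff, Set.mem_ofPred_eq, Set.mem_singleton_iff]
    tauto
  simp only [h1, taboo, ← ENNReal.tsum_mul_right, ← ENNReal.tsum_mul_left]
  rw [ENNReal.tsum_comm]
  exact tsum_congr fun x => tsum_congr fun y => by ring

/-- The bridge between paths and matrices: the Markov property at time `m` replaces `g` by `taboo p
C g`, which removes the last step. -/
lemma setLIntegral_avoid [Countable α] [IsProbabilityMeasure P] (hZ : IsAdaptedChain P ℱ Z p)
    (z : α) (m : ℕ) (C : Set α) (g : α → ℝ≥0∞) :
    ∫⁻ ω in {ω | ∀ l, 1 ≤ l → l ≤ m → Z z l ω ∉ C}, g (Z z m ω) ∂P = (taboo p C)^[m] g z := by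
  have hmeas : ∀ m, MeasurableSet[ℱ m] {ω | ∀ l, 1 ≤ l → l ≤ m → Z z l ω ∉ C} := by
    intro m
    simp only [Set.ofPred_forall]
    exact MeasurableSet.iInter fun l => MeasurableSet.iInter fun _ => MeasurableSet.iInter fun hl =>
      hZ.adapted z m l hl Cᶜ
  induction m generalizing g with
  | zero =>
    have : {ω | ∀ l, 1 ≤ l → l ≤ 0 → Z z l ω ∉ C} = Set.univ :=
      Set.eq_univ_of_forall fun ω l h1 h2 => absurd (h1.trans h2) (by simp)
    rw [this]
    simp [hZ.zero]
  | succ m ih =>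
    rw [Function.iterate_succ_apply, ← ih, ← hZ.setLIntegral_succ z m C g (hmeas m)]
    have hset : {ω | ∀ l, 1 ≤ l → l ≤ m + 1 → Z z l ω ∉ C} =
        {ω | Z z (m + 1) ω ∈ Cᶜ} ∩ {ω | ∀ l, 1 ≤ l → l ≤ m → Z z l ω ∉ C} := by
      ext ω
      constructor
      · exact fun h => ⟨h (m + 1) (by simp) le_rfl, fun l h1 hl => h l h1 (hl.trans (by simp))⟩
      · rintro ⟨h1, h2⟩ l h3 h4
        rcases Nat.le_succ_iff.1 h4 with h | rfl
        · exact h2 l h3 h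
        · exact h1
    rw [hset, ← setLIntegral_indicator (hZ.measurableSet z (m + 1) Cᶜ)]
    rfl

lemma measure_avoid [Countable α] [IsProbabilityMeasure P] (hZ : IsAdaptedChain P ℱ Z p)
    (z : α) (m : ℕ) (C : Set α) :
    P {ω | ∀ l, 1 ≤ l → l ≤ m → Z z l ω ∉ C} = (taboo p C)^[m] 1 z := by
  simpa using hZ.setLIntegral_avoid z m C 1

/-- The mean of an integer-valued time is the sum of its tail probabilities, and these are the taboo
iterates of 1. -/
lemma lintegral_entrance [Countable α] [IsProbabilityMeasure P] (hZ : IsAdaptedChain P ℱ Z p)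
    (z : α) (C : Set α) :
    ∫⁻ ω, ⨅ (m : ℕ) (_ : 1 ≤ m ∧ Z z m ω ∈ C), (m : ℝ≥0∞) ∂P = green p C 1 z := by
  have hmeas : ∀ m, MeasurableSet {ω | ∀ l, 1 ≤ l → l ≤ m → Z z l ω ∉ C} := by
    intro m
    simp only [Set.ofPred_forall]
    exact MeasurableSet.iInter fun l => MeasurableSet.iInter fun _ => MeasurableSet.iInter fun _ =>
      hZ.measurableSet z l Cᶜ
  have h1 : ∀ ω, (⨅ (m : ℕ) (_ : 1 ≤ m ∧ Z z m ω ∈ C), (m : ℝ≥0∞)) =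
      ∑' m : ℕ, {ω | ∀ l, 1 ≤ l → l ≤ m → Z z l ω ∉ C}.indicator (1 : Ω → ℝ≥0∞) ω :=
    fun ω => iInf_entrance_eq_tsum (fun m => Z z m ω) C
  simp only [h1]
  rw [lintegral_tsum fun m => (measurable_one.indicator (hmeas m)).aemeasurable, green]
  refine tsum_congr fun m => ?_
  rw [lintegral_indicator_one (hmeas m), hZ.measure_avoid]

lemma lintegral_one_step [Countable α] [IsProbabilityMeasure P] (hZ : IsAdaptedChain P ℱ Z p)
    (z : α) (g : α → ℝ≥0∞) : ∫⁻ ω, g (Z z 1 ω) ∂P = taboo p ∅ g z := by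
  simpa using hZ.setLIntegral_avoid z 1 ∅ g

lemma measure_eq [Countable α] [IsProbabilityMeasure P] (hZ : IsAdaptedChain P ℱ Z p)
    (z : α) (m : ℕ) (y : α) :
    P {ω | Z z m ω = y} = (taboo p ∅)^[m] (({y} : Set α).indicator 1) z := by
  rw [← hZ.setLIntegral_avoid z m ∅]
  have : ∀ ω, ({y} : Set α).indicator (1 : α → ℝ≥0∞) (Z z m ω) =
      {ω | Z z m ω ∈ ({y} : Set α)}.indicator 1 ω := fun ω => rfl
  simp only [this]
  rw [lintegral_indicator_one (hZ.measurableSet z m {y})]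
  simp

lemma transProb_eq [IsProbabilityMeasure P] (hZ : IsAdaptedChain P ℱ Z p) :
    transProb P Z = p := by
  ext z y
  simpa [hZ.zero, transProb] using hZ.markov z 0 Set.univ MeasurableSet.univ z y

lemma tsum_eq_one [Countable α] [IsProbabilityMeasure P] (hZ : IsAdaptedChain P ℱ Z p) (z : α) :
    ∑' y, p z y = 1 := by
  simpa [taboo] using (hZ.lintegral_one_step z 1).symm

lemma isMarkovChain [IsProbabilityMeasure P] (hZ : IsAdaptedChain P ℱ Z p) :
    IsMarkovChain P Z := by
  refine fun z => ⟨hZ.zero z, fun m x y => ?_⟩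
  have hE : MeasurableSet[ℱ m] {ω | ∀ l ≤ m, Z z l ω = x l} := by
    simp only [Set.ofPred_forall]
    exact MeasurableSet.iInter fun l => MeasurableSet.iInter fun hl => hZ.adapted z m l hl {x l}
  have h := hZ.markov z m _ hE (x m) y
  have h1 : {ω | ∀ l ≤ m, Z z l ω = x l} ∩ {ω | Z z m ω = x m} = {ω | ∀ l ≤ m, Z z l ω = x l} :=
    Set.inter_eq_left.2 fun ω hω => hω m le_rfl
  rw [h1] at h
  rw [hZ.transProb_eq, ← h]
  rfl

lemma posRecState_iff [Countable α] [IsProbabilityMeasure P] (hZ : IsAdaptedChain P ℱ Z p)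
    (z : α) : PosRecState P Z z ↔ green p {z} 1 z < ∞ := by
  rw [← hZ.lintegral_entrance z {z}]
  rfl

/-- Foster's criterion: if a finite function `V` has drift `≤ b - f` and the sublevel sets of `f`
are finite, then the chain is positive recurrent, and `f` has a finite mean under each stationary
distribution. -/
theorem positive_recurrence [Countable α] [Nonempty α] [IsProbabilityMeasure P]
    (hZ : IsAdaptedChain P ℱ Z p) {V f : α → ℝ≥0∞} {b : ℝ≥0∞} (hb : b ≠ ∞) (hV : ∀ z, V z ≠ ∞)
    (hdrift : ∀ z, ∫⁻ ω, V (Z z 1 ω) ∂P + f z ≤ V z + b) (hf : {z | f z < b + 1}.Finite) :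
    (∀ z, ∫⁻ ω, hitTime (fun m => Z z m ω) {z' | PosRecState P Z z'} ∂P < ∞) ∧
    (∀ C, IsIrreducibleClass P Z C →
      (∀ z ∈ C, PosRecState P Z z) ∧ ∃! ν : PMF α, IsStationary P Z ν ∧ ν.support ⊆ C) ∧
    (∃ ν : PMF α, IsStationary P Z ν) ∧
    (∀ ν : PMF α, IsStationary P Z ν → ∑' z, ν z * f z ≤ b) := by
  have hp := hZ.tsum_eq_one
  simp only [hZ.lintegral_one_step] at hdrift
  have hF : ∀ z, green p hf.toFinset 1 z < ∞ :=
    green_lt_top_of_drift hb hV hdrift fun z hz => by simpa using hz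
  have hR := green_posRec_lt_top hp hf.toFinset hF
  simp only [IsStationary, IsIrreducibleClass, hZ.transProb_eq, hZ.posRecState_iff, hZ.measure_eq]
  refine ⟨fun z => ?_, ?_, ?_, fun ν hν => tsum_mul_le_of_drift hp hV hdrift ν hν⟩
  · refine lt_of_le_of_lt (lintegral_mono fun ω => ?_) ((hZ.lintegral_entrance z _).trans_lt (hR z))
    -- `hitTime` also counts time 0, so it is at most the entrance time, which starts at 1.
    exact le_iInf₂ fun m hm => iInf₂_le m hm.2
  · rintro C ⟨⟨z, hz⟩, hC, hcom⟩
    have hfin : ∀ z ∈ C, ∀ y ∈ C, green p {z} 1 y < ∞ := fun z hz =>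
      green_singleton_lt_top hp hf.toFinset hF hC fun x hx => hcom x hx z hz
    refine ⟨fun z hz => hfin z hz z hz, excursionPMF z (hfin z hz z hz),
      ⟨excursionPMF_stationary hp z _, excursionPMF_support_subset hC hz _⟩, ?_⟩
    rintro ν ⟨hν, hνC⟩
    exact eq_excursionPMF hp hν _ fun y hy => hfin z hz y (hνC hy)
  · obtain ⟨z⟩ := ‹Nonempty α›
    obtain ⟨x, hx⟩ : {x | green p {x} 1 x < ∞}.Nonempty := by
      by_contra h
      -- Were there no positive recurrent state, the mean time to reach that empty set would be
      -- infinite.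
      have h2 := hR z
      rw [Set.not_nonempty_iff_eq_empty.1 h, green_one_eq_top_of_disjoint (A := Set.univ) hp
        (C := ∅) (fun _ _ _ _ => trivial) (fun y _ => Set.notMem_empty y) trivial] at h2
      exact lt_irrefl _ h2
    exact ⟨excursionPMF x hx, excursionPMF_stationary hp x hx⟩

end IsAdaptedChain
end Paths

/-! ### The sampled process is a Markov chain -/

section Sampled

variable {N : ℕ} {S K : Type*} (net : Network N S K) (pol : Rule N S K) (T : ℕ)

instance : Countable (QState N) :=
  Function.Injective.countable (f := fun q : QState N => (q.X, q.Y, q.U)) fun q q' h => by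
    simp only [Prod.mk.injEq] at h
    exact QState.ext h.1 h.2.1 h.2.2

instance : Nonempty (QState N) := ⟨⟨0, 0, 0⟩⟩

lemma frameRun_congr {s s' : ℕ → S} {a a' : ℕ → Fin N → ℕ} (z : QState N) (n : ℕ)
    (hs : ∀ l < n, s l = s' l) (ha : ∀ l < n, a l = a' l) :
    frameRun net pol T s a z n = frameRun net pol T s' a' z n := by
  induction n with
  | zero => rfl
  | succ n ih =>
    simp only [frameRun, hs n n.lt_succ_self, ha n n.lt_succ_self,
      ih (fun l hl => hs l (hl.trans n.lt_succ_self)) (fun l hl => ha l (hl.trans n.lt_succ_self))]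

lemma frameRun_snd_of_dvd (s : ℕ → S) (a : ℕ → Fin N → ℕ) (z : QState N) {n : ℕ} (hn : T ∣ n) :
    (frameRun net pol T s a z n).2 = (frameRun net pol T s a z n).1 := by
  cases n with
  | zero => rfl
  | succ n => simp [frameRun, hn]

/-- At a multiple of `T` the frozen state equals the current one, so the pair carries no extra
memory and the evolution restarts. -/
lemma frameRun_add (s : ℕ → S) (a : ℕ → Fin N → ℕ) (z : QState N) {m : ℕ} (hm : T ∣ m) (n : ℕ) :
    frameRun net pol T s a z (m + n) =
      frameRun net pol T (fun l => s (m + l)) (fun l => a (m + l))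
        (frameRun net pol T s a z m).1 n := by
  induction n with
  | zero => exact Prod.ext rfl (frameRun_snd_of_dvd net pol T s a z hm)
  | succ n ih =>
    rw [← add_assoc, frameRun, frameRun, ih]
    simp only [add_assoc, Nat.dvd_add_right hm]

variable {T}

/-- The queue state at the end of a frame with inputs `u` that starts in `q`. -/
def frameMap (hT : 0 < T) (u : Fin T → S × (Fin N → ℕ)) (q : QState N) : QState N :=
  (frameRun net pol T (fun n => (u ⟨n % T, Nat.mod_lt _ hT⟩).1)
    (fun n => (u ⟨n % T, Nat.mod_lt _ hT⟩).2) q T).1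

lemma sampled_succ {Ω : Type*} (hT : 0 < T) (s : ℕ → Ω → S) (a : ℕ → Ω → Fin N → ℕ)
    (z : QState N) (m : ℕ) (ω : Ω) :
    sampled net pol T s a z (m + 1) ω =
      frameMap net pol hT (fun t => (s (m * T + t) ω, a (m * T + t) ω))
        (sampled net pol T s a z m ω) := by
  rw [sampled, add_one_mul, frameRun_add net pol T _ _ z (Dvd.intro_left m rfl), frameMap]
  refine congrArg Prod.fst (frameRun_congr _ _ _ _ _ (fun l hl => ?_) fun l hl => ?_) <;>
    simp [Nat.mod_eq_of_lt hl]

variable {Ω : Type*} [MeasurableSpace Ω] {P : Measure Ω} {lam : Fin N → ℝ} [MeasurableSpace S]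
  {π : PMF S} {s : ℕ → Ω → S} {a : ℕ → Ω → Fin N → ℕ}

lemma IsIIDInput.measurable_slot (hin : IsIIDInput P π lam s a) (n : ℕ) :
    Measurable fun ω => (s n ω, a n ω) :=
  (hin.measurable_s n).prodMk (hin.measurable_a n)

variable [IsProbabilityMeasure P]

lemma IsIIDInput.law_slot (hin : IsIIDInput P π lam s a) (n : ℕ) :
    P.map (fun ω => (s n ω, a n ω)) = P.map (fun ω => (s 0 ω, a 0 ω)) := by
  rw [(indepFun_iff_map_prod_eq_prod_map_map (hin.measurable_s n).aemeasurable
      (hin.measurable_a n).aemeasurable).1 (hin.indep_s_a n),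
    (indepFun_iff_map_prod_eq_prod_map_map (hin.measurable_s 0).aemeasurable
      (hin.measurable_a 0).aemeasurable).1 (hin.indep_s_a 0), hin.law_s, hin.law_s, hin.law_a n]

lemma IsIIDInput.law_block (hin : IsIIDInput P π lam s a) (k : ℕ) :
    P.map (fun ω (t : Fin T) => (s (k + t) ω, a (k + t) ω)) =
      Measure.pi fun _ => P.map (fun ω => (s 0 ω, a 0 ω)) := by
  have hind : iIndepFun (fun (t : Fin T) ω => (s (k + t) ω, a (k + t) ω)) P :=
    hin.indep_slots.precomp (g := fun t : Fin T => k + t)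
      fun t t' h => Fin.ext (Nat.add_left_cancel h)
  rw [(iIndepFun_iff_map_fun_eq_pi_map fun t => (hin.measurable_slot _).aemeasurable).1 hind]
  congr 1
  ext1 t
  exact hin.law_slot _

variable [Finite S] [DiscreteMeasurableSpace S]

/-- The information up to the start of frame `m`. -/
abbrev frameFiltration (T : ℕ) (s : ℕ → Ω → S) (a : ℕ → Ω → Fin N → ℕ) (m : ℕ) :
    MeasurableSpace Ω :=
  MeasurableSpace.comap (fun ω (i : Finset.range (m * T)) => (s i ω, a i ω)) inferInstance

/-- The next sampled state is a fixed function of the present one and of the inputs of one frame;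
that block is independent of the earlier slots and has the same law as the first block. -/
lemma isAdaptedChain_sampled (hT : 0 < T) (hin : IsIIDInput P π lam s a) :
    IsAdaptedChain P (frameFiltration T s a) (sampled net pol T s a)
      fun x y => P {ω | sampled net pol T s a x 1 ω = y} := by
  classical
  -- A filler topology for slots beyond the observed ones, which do not influence the state in
  -- question.
  obtain ⟨s₀, -⟩ := π.support_nonempty
  have hadapted : ∀ z m l, l ≤ m → ∀ B : Set (QState N),
      MeasurableSet[frameFiltration T s a m] {ω | sampled net pol T s a z l ω ∈ B} := by
    intro z m l hl B
    let G : (Finset.range (m * T) → S × (Fin N → ℕ)) → QState N := fun r =>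
      (frameRun net pol T (fun n => if h : n ∈ Finset.range (m * T) then (r ⟨n, h⟩).1 else s₀)
        (fun n => if h : n ∈ Finset.range (m * T) then (r ⟨n, h⟩).2 else 0) z (l * T)).1
    refine ⟨G ⁻¹' B, MeasurableSet.of_discrete, ?_⟩
    ext ω
    have : G (fun i => (s i ω, a i ω)) = sampled net pol T s a z l ω := by
      refine congrArg Prod.fst (frameRun_congr _ _ _ _ _ (fun n hn => ?_) fun n hn => ?_) <;>
        simp [hn.trans_le (Nat.mul_le_mul_right T hl)]
    simp [this]
  refine ⟨fun z ω => by simp [sampled, frameRun], fun m => ?_, hadapted, ?_⟩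
  · exact Measurable.comap_le (measurable_pi_lambda _ fun i => hin.measurable_slot i)
  · intro z m E hE x y
    set block : ℕ → Ω → Fin T → S × (Fin N → ℕ) :=
      fun m ω t => (s (m * T + t) ω, a (m * T + t) ω) with hblock
    have hblock_meas : ∀ m, Measurable (block m) := fun m =>
      measurable_pi_lambda _ fun t => hin.measurable_slot _
    have hmap : ∀ m, P.map (block m) = P.map (block 0) := fun m => by
      rw [hblock, hin.law_block, hin.law_block]
    have hind : IndepFun (fun ω (i : Finset.range (m * T)) => (s i ω, a i ω)) (block m) P := by
      have hdisj : Disjoint (Finset.range (m * T)) (Finset.Ico (m * T) (m * T + T)) := by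
        rw [Finset.disjoint_left]
        intro i hi hi'
        simp only [Finset.mem_range, Finset.mem_Ico] at hi hi'
        omega
      have h := hin.indep_slots.indepFun_finset _ _ hdisj hin.measurable_slot
      exact h.comp (φ := id) (ψ := fun r (t : Fin T) => r ⟨m * T + t, by simp⟩) measurable_id
        (measurable_pi_lambda _ fun t => measurable_pi_apply _)
    obtain ⟨B, hB, hBE⟩ : MeasurableSet[frameFiltration T s a m]
        (E ∩ {ω | sampled net pol T s a z m ω = x}) :=
      MeasurableSet.inter hE (hadapted z m m le_rfl {x})
    have hset : E ∩ {ω | sampled net pol T s a z m ω = x} ∩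
        {ω | sampled net pol T s a z (m + 1) ω = y} =
        E ∩ {ω | sampled net pol T s a z m ω = x} ∩
          block m ⁻¹' {u | frameMap net pol hT u x = y} := by
      ext ω
      simp only [Set.mem_inter_iff, Set.mem_ofPred_eq, Set.mem_preimage]
      refine and_congr_right fun h => ?_
      rw [sampled_succ net pol hT, h.2]
    have hone : {ω | sampled net pol T s a x 1 ω = y} =
        block 0 ⁻¹' {u | frameMap net pol hT u x = y} := by
      ext ω
      have h1 := sampled_succ net pol hT s a x 0 ω
      rw [zero_add] at h1
      have h2 : sampled net pol T s a x 0 ω = x := by simp [sampled, frameRun]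
      rw [h2] at h1
      simp only [Set.mem_ofPred_eq, Set.mem_preimage, h1]
      rfl
    rw [hset, hone, ← hBE, hind.measure_inter_preimage_eq_mul _ _ hB MeasurableSet.of_discrete,
      ← Measure.map_apply (hblock_meas m) MeasurableSet.of_discrete, hmap m,
      Measure.map_apply (hblock_meas 0) MeasurableSet.of_discrete]

end Sampled

/-! ### The Lyapunov function along a frame -/

section Drift

variable {N : ℕ} {S K : Type*}

/-- The quadratic Lyapunov function. -/
def Network.lyapunov (net : Network N S K) (q : QState N) : ℝ :=
  ∑ i, ((q.X i : ℝ) ^ 2 + (q.Y i : ℝ) ^ 2 + (net.unit i * q.U i) ^ 2)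

/-- Total length of all queues. -/
def Network.backlog (net : Network N S K) (q : QState N) : ℝ :=
  ∑ i, ((q.X i : ℝ) + q.Y i + net.unit i * q.U i)

/-- The weight of a power vector together with a queue selection. -/
def Network.gain (net : Network N S K) (q : QState N) (s : S) (k : K) (own : Fin N → Bool) : ℝ :=
  ∑ i, (∑ j, ((q.X i : ℝ) - q.Y j) * net.rate s k i (some j)
    + (if own i = true then (q.X i : ℝ) else q.Y i) * net.rate s k i none
    - (net.unit i * q.U i) * net.power k i)

/-- `M` bounds what enters or leaves a queue in one slot, exogenous arrivals excepted. -/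
structure Network.BoundedBy (net : Network N S K) (M : ℕ) : Prop where
  outgoing : ∀ s k i, ∑ j, net.rate s k i (some j) + net.rate s k i none ≤ M
  incoming : ∀ s k i, ∑ j, net.rate s k j (some i) ≤ M
  tokens : ∀ k i, ∑ r, net.tokens k i r ≤ M
  budget : ∀ i, net.budget i ≤ M

lemma Network.exists_boundedBy [Finite S] [Finite K] (net : Network N S K) (A : ℕ) :
    ∃ M, A ≤ M ∧ net.BoundedBy M := by
  obtain ⟨M₁, h₁⟩ := (Set.finite_range fun x : S × K × Fin N =>
    ∑ j, net.rate x.1 x.2.1 x.2.2 (some j) + net.rate x.1 x.2.1 x.2.2 none).bddAbove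
  obtain ⟨M₂, h₂⟩ := (Set.finite_range fun x : S × K × Fin N =>
    ∑ j, net.rate x.1 x.2.1 j (some x.2.2)).bddAbove
  obtain ⟨M₃, h₃⟩ := (Set.finite_range fun x : K × Fin N => ∑ r, net.tokens x.1 x.2 r).bddAbove
  obtain ⟨M₄, h₄⟩ := (Set.finite_range net.budget).bddAbove
  refine ⟨A + M₁ + M₂ + M₃ + M₄, by omega, fun s k i => ?_, fun s k i => ?_, fun k i => ?_,
    fun i => ?_⟩
  · have := h₁ ⟨(s, k, i), rfl⟩
    simp only at this
    omega
  · have := h₂ ⟨(s, k, i), rfl⟩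
    simp only at this
    omega
  · have := h₃ ⟨(k, i), rfl⟩
    simp only at this
    omega
  · have := h₄ ⟨i, rfl⟩
    omega

lemma Network.lyapunov_nonneg (net : Network N S K) (q : QState N) : 0 ≤ net.lyapunov q :=
  Finset.sum_nonneg fun _ _ => by positivity

lemma Network.le_backlog (net : Network N S K) (q : QState N) (i : Fin N) :
    (q.X i : ℝ) + q.Y i + net.unit i * q.U i ≤ net.backlog q :=
  Finset.single_le_sum (f := fun i => (q.X i : ℝ) + q.Y i + net.unit i * q.U i)
    (fun i _ => by have := (net.unit_pos i).le; positivity) (Finset.mem_univ i)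

lemma Network.backlog_nonneg (net : Network N S K) (q : QState N) : 0 ≤ net.backlog q :=
  Finset.sum_nonneg fun i _ => by
    have := (net.unit_pos i).le
    positivity

lemma Network.weight_eq_gain (net : Network N S K) {pol : Rule N S K} (hpol : pol.IsMaxWeight net)
    (q : QState N) (s : S) (k : K) : net.weight q s k = net.gain q s k (pol.own q s) := by
  refine Finset.sum_congr rfl fun i _ => ?_
  congr 3
  by_cases h : pol.own q s i = true
  · rw [if_pos h, max_eq_left (Nat.cast_le.2 (((hpol q s).2 i).1 h))]
  · rw [if_neg h, max_eq_right (Nat.cast_le.2 (((hpol q s).2 i).2 (by simpa using h)))]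

lemma Network.gain_le_weight (net : Network N S K) (q : QState N) (s : S) (k : K)
    (own : Fin N → Bool) : net.gain q s k own ≤ net.weight q s k := by
  refine Finset.sum_le_sum fun i _ => ?_
  gcongr
  split_ifs
  · exact le_max_left _ _
  · exact le_max_right _ _

/-- The gain, arranged by queues. -/
lemma Network.gain_eq (net : Network N S K) (q : QState N) (s : S) (k : K) (own : Fin N → Bool) :
    net.gain q s k own = ∑ i, ((q.X i : ℝ) *
        ((∑ j, net.rate s k i (some j) + if own i = true then net.rate s k i none else 0 : ℕ) : ℝ)
      + (q.Y i : ℝ) * (((if own i = true then 0 else net.rate s k i none : ℕ) : ℝ)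
        - ((∑ j, net.rate s k j (some i) : ℕ) : ℝ))
      - (net.unit i) ^ 2 * ((q.U i : ℝ) * ((∑ r, net.tokens k i r : ℕ) : ℝ))) := by
  have hswap : ∑ i, ∑ j, (q.Y j : ℝ) * net.rate s k i (some j) =
      ∑ i, (q.Y i : ℝ) * ((∑ j, net.rate s k j (some i) : ℕ) : ℝ) := by
    rw [Finset.sum_comm]
    simp [Finset.mul_sum]
  have h1 : net.gain q s k own = ∑ i, ((q.X i : ℝ) *
        ((∑ j, net.rate s k i (some j) + if own i = true then net.rate s k i none else 0 : ℕ) : ℝ)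
      + (q.Y i : ℝ) * (((if own i = true then 0 else net.rate s k i none : ℕ) : ℝ))
      - (net.unit i) ^ 2 * ((q.U i : ℝ) * ((∑ r, net.tokens k i r : ℕ) : ℝ)))
      - ∑ i, ∑ j, (q.Y j : ℝ) * net.rate s k i (some j) := by
    rw [← Finset.sum_sub_distrib]
    refine Finset.sum_congr rfl fun i _ => ?_
    simp only [sub_mul, Finset.sum_sub_distrib, ← Finset.mul_sum, Network.power]
    by_cases h : own i = true
    · simp only [h, if_true]
      push_cast
      ring
    · simp only [h]
      push_cast
      ring
  rw [h1, hswap, ← Finset.sum_sub_distrib]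
  exact Finset.sum_congr rfl fun i _ => by ring

/-! ### One-slot estimates -/

/-- One-slot change of the square of a queue. -/
lemma sq_queue_le {x x₀ d μ r B M : ℕ} (hd : d ≤ μ) (hμ : μ ≤ M)
    (hr : r ≤ M) (hxd : x * μ ≤ x * d + M ^ 2) (hB : |(x : ℝ) - x₀| ≤ B) :
    ((x - d + r : ℕ) : ℝ) ^ 2 ≤
      (x : ℝ) ^ 2 + 2 * (x₀ * ((r : ℝ) - μ)) + (3 * (M : ℝ) ^ 2 + 2 * B * M) := by
  have hd' : (d : ℝ) ≤ μ := by exact_mod_cast hd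
  have hμ' : (μ : ℝ) ≤ M := by exact_mod_cast hμ
  have hr' : (r : ℝ) ≤ M := by exact_mod_cast hr
  have hxd' : (x : ℝ) * μ ≤ x * d + (M : ℝ) ^ 2 := by exact_mod_cast hxd
  have d0 : (0 : ℝ) ≤ d := by positivity
  have r0 : (0 : ℝ) ≤ r := by positivity
  have x0 : (0 : ℝ) ≤ x := by positivity
  -- The current length is replaced by the frozen `x₀`: the error is at most the distance `B` times
  -- the net flow bound `M`.
  have hfreeze : (x : ℝ) * (r - μ) ≤ x₀ * (r - μ) + B * M := by
    have h1 : |((x : ℝ) - x₀) * (r - μ)| ≤ B * M := by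
      rw [abs_mul]
      refine mul_le_mul hB ?_ (abs_nonneg _) (by positivity)
      rw [abs_le]
      constructor <;> linarith
    have := (abs_le.1 h1).2
    linarith [sub_mul (x : ℝ) x₀ (r - μ)]
  suffices h : ((x - d + r : ℕ) : ℝ) ^ 2 ≤
      (x : ℝ) ^ 2 + 2 * (x * ((r : ℝ) - μ)) + 3 * (M : ℝ) ^ 2 by linarith
  have hM2 : (r : ℝ) ^ 2 ≤ (M : ℝ) ^ 2 := by gcongr
  rcases le_total d x with h | h
  · push_cast [h]
    have h2 : ((d : ℝ) - r) ^ 2 ≤ (M : ℝ) ^ 2 := by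
      rw [sq_le_sq, abs_of_nonneg (by positivity : (0 : ℝ) ≤ M), abs_le]
      constructor <;> linarith
    nlinarith
  -- The queue empties, so it was shorter than `M` and all terms are of order `M ^ 2`.
  · rw [Nat.sub_eq_zero_of_le h, zero_add]
    have hx : (x : ℝ) ≤ M := (by exact_mod_cast h : (x : ℝ) ≤ d).trans (hd'.trans hμ')
    have h3 : (x : ℝ) * μ ≤ (M : ℝ) ^ 2 := by
      calc (x : ℝ) * μ ≤ M * M := by gcongr
        _ = (M : ℝ) ^ 2 := by ring
    nlinarith [mul_nonneg x0 r0, sq_nonneg (x : ℝ)]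

lemma abs_queue_sub_le {x d r M : ℕ} (hd : d ≤ M) (hr : r ≤ M) :
    |((x - d + r : ℕ) : ℝ) - x| ≤ M := by
  rw [abs_le]
  constructor
  · have : x ≤ x - d + r + M := by omega
    have : (x : ℝ) ≤ ((x - d + r : ℕ) : ℝ) + M := by exact_mod_cast this
    linarith
  · have : x - d + r ≤ x + M := by omega
    have : ((x - d + r : ℕ) : ℝ) ≤ x + M := by exact_mod_cast this
    linarith

/-- Service is wasted only when `x ≤ r ≤ M`, so weighting the waste by `x` costs at most `r * M`.
The factor `r` lets these errors add up over the links to `M ^ 2`. -/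
lemma mul_le_mul_min_add (x r : ℕ) {M : ℕ} (hr : r ≤ M) : x * r ≤ x * min x r + r * M := by
  rcases le_total x r with h | h
  · calc x * r = r * x := mul_comm _ _
      _ ≤ r * M := Nat.mul_le_mul_left _ (h.trans hr)
      _ ≤ _ := Nat.le_add_left _ _
  · rw [min_eq_right h]
    exact Nat.le_add_right _ _

/-- Componentwise distance at most `B`. -/
def QState.Near (B : ℕ) (q z : QState N) : Prop :=
  ∀ i, |(q.X i : ℝ) - z.X i| ≤ B ∧ |(q.Y i : ℝ) - z.Y i| ≤ B ∧ |(q.U i : ℝ) - z.U i| ≤ B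

variable {net : Network N S K} {M : ℕ}

namespace Network.BoundedBy

lemma own_le (hM : net.BoundedBy M) (s : S) (k : K) (own : Fin N → Bool) (i : Fin N) :
    ∑ j, net.rate s k i (some j) + (if own i = true then net.rate s k i none else 0) ≤ M := by
  refine le_trans ?_ (hM.outgoing s k i)
  split_ifs <;> simp

lemma served_own_le (x : ℕ) (s : S) (k : K) (own : Fin N → Bool) (i : Fin N) :
    ∑ j, min x (net.rate s k i (some j)) +
        (if own i = true then min x (net.rate s k i none) else 0) ≤
      ∑ j, net.rate s k i (some j) + (if own i = true then net.rate s k i none else 0) := by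
  gcongr
  · exact min_le_right _ _
  · split_ifs <;> simp

lemma relay_le (hM : net.BoundedBy M) (s : S) (k : K) (own : Fin N → Bool) (i : Fin N) :
    (if own i = true then 0 else net.rate s k i none) ≤ M := by
  refine le_trans ?_ (hM.outgoing s k i)
  split_ifs <;> simp

lemma served_relay_le (x : ℕ) (s : S) (k : K) (own : Fin N → Bool) (i : Fin N) :
    (if own i = true then 0 else min x (net.rate s k i none)) ≤
      (if own i = true then 0 else net.rate s k i none) := by
  split_ifs <;> simp

lemma relayed_le (x : Fin N → ℕ) (s : S) (k : K) (i : Fin N) :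
    ∑ j, min (x j) (net.rate s k j (some i)) ≤ ∑ j, net.rate s k j (some i) :=
  Finset.sum_le_sum fun _ _ => min_le_right _ _

lemma mul_own_le (hM : net.BoundedBy M) (x : ℕ) (s : S) (k : K) (own : Fin N → Bool) (i : Fin N) :
    x * (∑ j, net.rate s k i (some j) + (if own i = true then net.rate s k i none else 0)) ≤
      x * (∑ j, min x (net.rate s k i (some j)) +
        (if own i = true then min x (net.rate s k i none) else 0)) + M ^ 2 := by
  have h := hM.own_le s k own i
  have h1 : ∑ j, x * net.rate s k i (some j) ≤
      ∑ j, (x * min x (net.rate s k i (some j)) + net.rate s k i (some j) * M) :=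
    Finset.sum_le_sum fun j _ => mul_le_mul_min_add _ _ <|
      (Finset.single_le_sum (f := fun j => net.rate s k i (some j)) (fun _ _ => Nat.zero_le _)
        (Finset.mem_univ j)).trans (le_self_add.trans h)
  have h2 : x * (if own i = true then net.rate s k i none else 0) ≤
      x * (if own i = true then min x (net.rate s k i none) else 0) +
        (if own i = true then net.rate s k i none else 0) * M := by
    split_ifs with h3
    · rw [if_pos h3] at h
      exact mul_le_mul_min_add _ _ (le_add_self.trans h)
    · simp
  rw [Finset.sum_add_distrib, ← Finset.mul_sum, ← Finset.mul_sum, ← Finset.sum_mul] at h1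
  nlinarith [Nat.mul_le_mul_right M h]

lemma mul_relay_le (hM : net.BoundedBy M) (x : ℕ) (s : S) (k : K) (own : Fin N → Bool)
    (i : Fin N) :
    x * (if own i = true then 0 else net.rate s k i none) ≤
      x * (if own i = true then 0 else min x (net.rate s k i none)) + M ^ 2 := by
  have h := hM.relay_le s k own i
  split_ifs with h3
  · simp
  · rw [if_neg h3] at h
    exact (mul_le_mul_min_add _ _ h).trans (by rw [sq]; gcongr)

lemma near_step (hM : net.BoundedBy M) {q z : QState N} {B : ℕ} (hq : q.Near B z) (k : K)
    (own : Fin N → Bool) (s : S) {a : Fin N → ℕ} (ha : ∀ i, a i ≤ M) :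
    (net.step q k own s a).Near (B + M) z := by
  have key : ∀ {x y w : ℝ}, |x - y| ≤ M → |y - w| ≤ B → |x - w| ≤ ((B + M : ℕ) : ℝ) := by
    intro x y w h1 h2
    push_cast
    linarith [abs_sub_le x y w]
  intro i
  obtain ⟨h1, h2, h3⟩ := hq i
  refine ⟨key (abs_queue_sub_le ?_ (ha i)) h1, key (abs_queue_sub_le ?_ ?_) h2,
    key (abs_queue_sub_le (hM.budget i) (hM.tokens k i)) h3⟩
  · exact (served_own_le _ s k own i).trans (hM.own_le s k own i)
  · exact (served_relay_le _ s k own i).trans (hM.relay_le s k own i)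
  · exact (relayed_le _ s k i).trans (hM.incoming s k i)

/-- One-slot change of the Lyapunov function, in terms of a nearby state `z`. -/
lemma lyapunov_step_le (hM : net.BoundedBy M) {q z : QState N} {B : ℕ} (hq : q.Near B z) (k : K)
    (own : Fin N → Bool) (s : S) {a : Fin N → ℕ} (ha : ∀ i, a i ≤ M) :
    net.lyapunov (net.step q k own s a) ≤ net.lyapunov q
      + 2 * (∑ i, ((z.X i : ℝ) * a i - net.unit i * z.U i * net.avgPower i) - net.gain z s k own)
      + ∑ i, (2 + net.unit i ^ 2) * (3 * (M : ℝ) ^ 2 + 2 * B * M) := by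
  rw [net.gain_eq, ← Finset.sum_sub_distrib, Finset.mul_sum, Network.lyapunov, Network.lyapunov,
    ← Finset.sum_add_distrib, ← Finset.sum_add_distrib]
  refine Finset.sum_le_sum fun i _ => ?_
  obtain ⟨h1, h2, h3⟩ := hq i
  have hX := sq_queue_le (r := a i) (served_own_le (q.X i) s k own i) (hM.own_le s k own i)
    (ha i) (hM.mul_own_le (q.X i) s k own i) h1
  have hin := relayed_le q.X s k i (net := net)
  have hY := sq_queue_le (served_relay_le (q.Y i) s k own i) (hM.relay_le s k own i)
    (hin.trans (hM.incoming s k i)) (hM.mul_relay_le (q.Y i) s k own i) h2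
  -- For the virtual queue the offered service is the budget itself, and truncated subtraction plays
  -- the role of max(·, 0).
  have hU := sq_queue_le le_rfl (hM.budget i) (hM.tokens k i) (Nat.le_add_right _ _) h3
  have hY' : (z.Y i : ℝ) * ((∑ j, min (q.X j) (net.rate s k j (some i)) : ℕ) : ℝ) ≤
      z.Y i * ((∑ j, net.rate s k j (some i) : ℕ) : ℝ) := by
    have : ((∑ j, min (q.X j) (net.rate s k j (some i)) : ℕ) : ℝ) ≤
        ((∑ j, net.rate s k j (some i) : ℕ) : ℝ) := by exact_mod_cast hin
    gcongr
  have hU' := mul_le_mul_of_nonneg_left hU (sq_nonneg (net.unit i))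
  simp only [Network.step, Network.avgPower]
  set x' : ℝ := (((q.X i - (_ + _)) + a i : ℕ) : ℝ)
  set y' : ℝ := (((q.Y i - _) + _ : ℕ) : ℝ)
  set u' : ℝ := (((q.U i - net.budget i) + _ : ℕ) : ℝ)
  rw [mul_pow]
  nlinarith

end Network.BoundedBy

end Drift

/-! ### Change of the Lyapunov function over a frame -/

section Frame

variable {N : ℕ} {S K : Type*} {net : Network N S K} {M : ℕ}

lemma QState.Near.mono {B B' : ℕ} {q z : QState N} (h : q.Near B z) (hB : B ≤ B') :
    q.Near B' z := by
  have hB' : (B : ℝ) ≤ B' := by exact_mod_cast hB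
  exact fun i => ⟨(h i).1.trans hB', (h i).2.1.trans hB', (h i).2.2.trans hB'⟩

/-- What the Lyapunov function may gain in a frame of `T` slots, apart from its drift. -/
def Network.slack (net : Network N S K) (M T : ℕ) : ℝ :=
  ∑ i, (2 + net.unit i ^ 2) * (3 * (M : ℝ) ^ 2 + 2 * (T * M : ℕ) * M)

lemma Network.slack_nonneg (net : Network N S K) (M T : ℕ) : 0 ≤ net.slack M T :=
  Finset.sum_nonneg fun _ _ => by positivity

/-- Change of the Lyapunov function within a frame. -/
lemma lyapunov_frameRun_le (hM : net.BoundedBy M) {pol : Rule N S K} (hpol : pol.IsMaxWeight net)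
    {T : ℕ} {s : ℕ → S} {a : ℕ → Fin N → ℕ} (ha : ∀ l i, a l i ≤ M) (z : QState N) (n : ℕ)
    (hn : n ≤ T) :
    (n < T → (frameRun net pol T s a z n).2 = z) ∧
    (frameRun net pol T s a z n).1.Near (n * M) z ∧
    net.lyapunov (frameRun net pol T s a z n).1 ≤ net.lyapunov z +
      ∑ l ∈ Finset.range n,
        (2 * (∑ i, ((z.X i : ℝ) * a l i - net.unit i * z.U i * net.avgPower i)
          - net.weight z (s l) (pol.choice z (s l))) + net.slack M T) := by
  induction n with
  | zero => simp [frameRun, QState.Near]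
  | succ n ih =>
    obtain ⟨h1, h2, h3⟩ := ih (Nat.le_of_succ_le hn)
    have hz := h1 hn
    refine ⟨fun hlt => ?_, ?_, ?_⟩
    · have : ¬ T ∣ n + 1 := fun h => absurd (Nat.le_of_dvd n.succ_pos h) (not_le.2 hlt)
      simp [frameRun, this, hz]
    · rw [add_one_mul]
      exact hM.near_step h2 _ _ _ (ha n)
    · simp only [frameRun, hz]
      refine (hM.lyapunov_step_le (h2.mono (Nat.mul_le_mul_right M (Nat.le_of_succ_le hn)))
        _ _ _ (ha n)).trans ?_
      rw [← net.weight_eq_gain hpol, Finset.sum_range_succ]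
      simp only [Network.slack] at h3 ⊢
      linarith

end Frame

/-! ### Stabilizable rate vectors -/

section Stable

lemma timeAvg_add (f g : ℕ → ℝ) : timeAvg (fun n => f n + g n) = timeAvg f + timeAvg g := by
  ext n
  simp [timeAvg, Finset.sum_add_distrib, add_div]

lemma timeAvg_sub (f g : ℕ → ℝ) : timeAvg (fun n => f n - g n) = timeAvg f - timeAvg g := by
  ext n
  simp [timeAvg, Finset.sum_sub_distrib, sub_div]

lemma timeAvg_const_mul (c : ℝ) (f : ℕ → ℝ) :
    timeAvg (fun n => c * f n) = fun n => c * timeAvg f n := by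
  ext n
  simp [timeAvg, ← Finset.mul_sum, mul_div_assoc]

lemma timeAvg_sum {ι : Type*} (t : Finset ι) (f : ι → ℕ → ℝ) :
    timeAvg (fun n => ∑ i ∈ t, f i n) = fun n => ∑ i ∈ t, timeAvg (f i) n := by
  ext n
  simp only [timeAvg]
  rw [Finset.sum_comm, Finset.sum_div]

lemma abs_timeAvg_le {f : ℕ → ℝ} {B : ℝ} (hf : ∀ n, |f n| ≤ B) (n : ℕ) : |timeAvg f n| ≤ B := by
  have hB : 0 ≤ B := (abs_nonneg _).trans (hf 0)
  rw [timeAvg, abs_div, Nat.abs_cast]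
  refine div_le_of_le_mul₀ (by positivity) hB ?_
  calc |∑ m ∈ Finset.range n, f m| ≤ ∑ m ∈ Finset.range n, |f m| := Finset.abs_sum_le_sum_abs _ _
    _ ≤ ∑ m ∈ Finset.range n, B := Finset.sum_le_sum fun m _ => hf m
    _ = B * n := by simp [mul_comm]

variable {N : ℕ} {S K : Type*} [MeasurableSpace S] [MeasurableSpace K]
  {net : Network N S K} {π : PMF S} {lam : Fin N → ℝ}

/-- Mean gain of a policy with the given service rates and powers. -/
def Network.meanGain (net : Network N S K) (q : QState N) (linkRate : Fin N → Fin N → ℝ)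
    (ownRate relayRate pow : Fin N → ℝ) : ℝ :=
  ∑ i, (∑ j, ((q.X i : ℝ) - q.Y j) * linkRate i j
    + ((q.X i : ℝ) * ownRate i + q.Y i * relayRate i) - (net.unit i * q.U i) * pow i)

variable {δ : ℝ} {Ω : Type*} [MeasurableSpace Ω] {P : Measure Ω} {s : ℕ → Ω → S} {k : ℕ → Ω → K}
  {own : ℕ → Ω → Fin N → Bool} {linkRate : Fin N → Fin N → ℝ} {ownRate relayRate pow : Fin N → ℝ}

/-- Arranged by queues, the mean gain weights each rate condition by the length of its queue; the
margins δ then add up to δ times the backlog. -/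
lemma IsRateStable.le_meanGain
    (hst : IsRateStable net π lam δ P s k own linkRate ownRate relayRate pow) (q : QState N) :
    ∑ i, ((q.X i : ℝ) * lam i - net.unit i * q.U i * net.avgPower i) + δ * net.backlog q ≤
      net.meanGain q linkRate ownRate relayRate pow := by
  have hswap : ∑ i, ∑ j, (q.Y j : ℝ) * linkRate i j = ∑ i, (q.Y i : ℝ) * ∑ j, linkRate j i := by
    rw [Finset.sum_comm]
    simp [Finset.mul_sum]
  have h2 : net.meanGain q linkRate ownRate relayRate pow =
      ∑ i, ((q.X i : ℝ) * (ownRate i + ∑ j, linkRate i j)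
        + q.Y i * relayRate i - (net.unit i * q.U i) * pow i)
        - ∑ i, ∑ j, (q.Y j : ℝ) * linkRate i j := by
    rw [Network.meanGain, ← Finset.sum_sub_distrib]
    refine Finset.sum_congr rfl fun i _ => ?_
    simp only [sub_mul, Finset.sum_sub_distrib, ← Finset.mul_sum]
    ring
  rw [h2, hswap, ← Finset.sum_sub_distrib, Network.backlog, Finset.mul_sum,
    ← Finset.sum_add_distrib]
  refine Finset.sum_le_sum fun i _ => ?_
  have hu : 0 ≤ net.unit i * q.U i := mul_nonneg (net.unit_pos i).le (Nat.cast_nonneg _)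
  have e1 := mul_le_mul_of_nonneg_left (hst.own_stable i) (Nat.cast_nonneg (α := ℝ) (q.X i))
  have e2 := mul_le_mul_of_nonneg_left (hst.relay_stable i) (Nat.cast_nonneg (α := ℝ) (q.Y i))
  have e3 := mul_le_mul_of_nonneg_left (hst.feasible i) hu
  linarith

lemma IsRateStable.tendsto_timeAvg_gain
    (hst : IsRateStable net π lam δ P s k own linkRate ownRate relayRate pow) (q : QState N) :
    ∀ᵐ ω ∂P, Tendsto (timeAvg fun n => net.gain q (s n ω) (k n ω) (own n ω)) atTop
      (𝓝 (net.meanGain q linkRate ownRate relayRate pow)) := by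
  have hlink : ∀ᵐ ω ∂P, ∀ i j, Tendsto (timeAvg fun n =>
      (net.rate (s n ω) (k n ω) i (some j) : ℝ)) atTop (𝓝 (linkRate i j)) :=
    ae_all_iff.2 fun i => ae_all_iff.2 fun j => hst.link i j
  filter_upwards [hlink, ae_all_iff.2 hst.own_rate, ae_all_iff.2 hst.relay_rate,
    ae_all_iff.2 hst.power] with ω h1 h2 h3 h4
  have hGω : (fun n => net.gain q (s n ω) (k n ω) (own n ω)) = fun n => ∑ i,
      (∑ j, ((q.X i : ℝ) - q.Y j) * (net.rate (s n ω) (k n ω) i (some j) : ℝ)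
      + ((q.X i : ℝ) * (if own n ω i = true then (net.rate (s n ω) (k n ω) i none : ℝ) else 0)
        + q.Y i * (if own n ω i = true then 0 else (net.rate (s n ω) (k n ω) i none : ℝ)))
      - (net.unit i * q.U i) * net.power (k n ω) i) := by
    ext n
    refine Finset.sum_congr rfl fun i _ => ?_
    congr 2
    split_ifs <;> simp
  rw [hGω]
  simp only [timeAvg_sum, timeAvg_sub, timeAvg_add, timeAvg_const_mul, Pi.add_apply,
    Pi.sub_apply]
  refine tendsto_finsetSum _ fun i _ => Tendsto.sub (Tendsto.add ?_ ?_) ((h4 i).const_mul _)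
  · exact tendsto_finsetSum _ fun j _ => (h1 i j).const_mul _
  · exact ((h2 i).const_mul _).add ((h3 i).const_mul _)

/-- If the time averages of bounded variables converge a.s. to a constant `L`, and their means are
at most `w`, then `L ≤ w`. -/
lemma le_of_tendsto_timeAvg [IsProbabilityMeasure P] {G : ℕ → Ω → ℝ} {B L w : ℝ}
    (hmeas : ∀ n, Measurable (G n)) (hB : ∀ n ω, |G n ω| ≤ B)
    (hlim : ∀ᵐ ω ∂P, Tendsto (timeAvg fun n => G n ω) atTop (𝓝 L)) (hw : ∀ n, ∫ ω, G n ω ∂P ≤ w) :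
    L ≤ w := by
  have hmeasAvg : ∀ n, Measurable fun ω => timeAvg (fun n => G n ω) n := fun n =>
    (Finset.measurable_fun_sum _ fun m _ => hmeas m).div_const _
  have hconv : Tendsto (fun n => ∫ ω, timeAvg (fun n => G n ω) n ∂P) atTop (𝓝 L) := by
    have := tendsto_integral_of_dominated_convergence (μ := P) (fun _ => B)
      (fun n => (hmeasAvg n).aestronglyMeasurable) (integrable_const B)
      (fun n => ae_of_all _ fun ω => abs_timeAvg_le (fun m => hB m ω) n) hlim
    simpa using this
  refine le_of_tendsto hconv ?_
  filter_upwards [eventually_gt_atTop 0] with n hn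
  have hn' : (0 : ℝ) < n := by exact_mod_cast hn
  simp only [timeAvg]
  rw [integral_div, integral_finsetSum _ fun m _ =>
    Integrable.of_bound (hmeas m).aestronglyMeasurable B (ae_of_all _ (hB m)), div_le_iff₀ hn']
  calc ∑ m ∈ Finset.range n, ∫ ω, G m ω ∂P ≤ ∑ m ∈ Finset.range n, w :=
        Finset.sum_le_sum fun m _ => hw m
    _ = w * n := by simp [mul_comm]

lemma integrable_comp_of_finite {β : Type*} [Finite β] [MeasurableSpace β]
    [DiscreteMeasurableSpace β] [IsFiniteMeasure P] {f : Ω → β} (hf : Measurable f) (W : β → ℝ) :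
    Integrable (fun ω => W (f ω)) P := by
  obtain ⟨B, hB⟩ := (Set.finite_range fun x => |W x|).bddAbove
  exact Integrable.of_bound
    ((Measurable.of_discrete (f := W)).comp hf).aestronglyMeasurable B
    (ae_of_all _ fun ω => hB ⟨f ω, rfl⟩)

variable [Finite S] [Finite K] [DiscreteMeasurableSpace S] [DiscreteMeasurableSpace K]

/-- A weight that dominates the gain of each decision exceeds in the mean, by a multiple of the
backlog, what is needed to serve the arrivals within the power budgets. -/
lemma IsRateStable.margin_le [IsProbabilityMeasure P]
    (hst : IsRateStable net π lam δ P s k own linkRate ownRate relayRate pow) (q : QState N)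
    (W : S → ℝ) (hW : ∀ s k own, net.gain q s k own ≤ W s) :
    ∑ i, ((q.X i : ℝ) * lam i - net.unit i * q.U i * net.avgPower i) + δ * net.backlog q ≤
      ∫ s, W s ∂π.toMeasure := by
  refine (hst.le_meanGain q).trans ?_
  obtain ⟨B, hB⟩ := (Set.finite_range fun x : S × K × (Fin N → Bool) =>
    |net.gain q x.1 x.2.1 x.2.2|).bddAbove
  have hmeas : ∀ n, Measurable fun ω => (s n ω, k n ω, own n ω) := fun n =>
    (hst.measurable_s n).prodMk ((hst.measurable_k n).prodMk (hst.measurable_own n))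
  refine le_of_tendsto_timeAvg (B := B) (fun n => (Measurable.of_discrete
    (f := fun x : S × K × (Fin N → Bool) => net.gain q x.1 x.2.1 x.2.2)).comp (hmeas n))
    (fun n ω => hB ⟨(s n ω, k n ω, own n ω), rfl⟩) (hst.tendsto_timeAvg_gain q) fun n => ?_
  rw [← hst.law_s n, integral_map (hst.measurable_s n).aemeasurable
    (Measurable.of_discrete (f := W)).aestronglyMeasurable]
  -- No conditioning on the past is needed: `W` dominates every decision pointwise, and only the law
  -- of the topology enters its mean.
  exact integral_mono (integrable_comp_of_finite (hmeas n)
    fun x : S × K × (Fin N → Bool) => net.gain q x.1 x.2.1 x.2.2)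
    (integrable_comp_of_finite (hst.measurable_s n) W) fun ω => hW _ _ _

end Stable

/-! ### Mean drift over a frame -/

section Main

variable {N : ℕ} {S K : Type*}

lemma finite_backlog_le (net : Network N S K) (R : ℝ) : {q | net.backlog q ≤ R}.Finite := by
  obtain ⟨R', hR'⟩ : ∃ R' : ℕ, ∀ i, R ≤ R' ∧ R / net.unit i ≤ R' := by
    obtain ⟨b, hb⟩ := (Set.finite_range fun i => R / net.unit i).bddAbove
    obtain ⟨n, hn⟩ := exists_nat_ge (max R b)
    exact ⟨n, fun i => ⟨(le_max_left _ _).trans hn,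
      (hb ⟨i, rfl⟩).trans ((le_max_right _ _).trans hn)⟩⟩
  have hfin : (Set.Iic (fun _ : Fin N => R')).Finite := Set.finite_Iic _
  refine ((hfin.prod (hfin.prod hfin)).preimage
    (f := fun q : QState N => (q.X, q.Y, q.U)) ?_).subset fun q hq => ?_
  · intro q _ q' _ h
    simp only [Prod.mk.injEq] at h
    exact QState.ext h.1 h.2.1 h.2.2
  · have key : ∀ i, (q.X i : ℝ) + q.Y i + net.unit i * q.U i ≤ R := fun i =>
      (net.le_backlog q i).trans hq
    have hU : ∀ i, 0 ≤ net.unit i * (q.U i : ℝ) := fun i =>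
      mul_nonneg (net.unit_pos i).le (Nat.cast_nonneg _)
    refine ⟨fun i => ?_, fun i => ?_, fun i => ?_⟩
    · have : (q.X i : ℝ) ≤ R' := by
        linarith [key i, hU i, (hR' i).1, (Nat.cast_nonneg (q.Y i) : (0 : ℝ) ≤ _)]
      exact_mod_cast this
    · have : (q.Y i : ℝ) ≤ R' := by
        linarith [key i, hU i, (hR' i).1, (Nat.cast_nonneg (q.X i) : (0 : ℝ) ≤ _)]
      exact_mod_cast this
    · have h1 : (q.U i : ℝ) ≤ R / net.unit i := by
        rw [le_div_iff₀ (net.unit_pos i), mul_comm]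
        linarith [key i, (Nat.cast_nonneg (q.X i) : (0 : ℝ) ≤ _),
          (Nat.cast_nonneg (q.Y i) : (0 : ℝ) ≤ _)]
      exact_mod_cast h1.trans (hR' i).2

variable [Finite S] [MeasurableSpace S] [DiscreteMeasurableSpace S]
  {net : Network N S K} {π : PMF S} {lam : Fin N → ℝ}
  {Ω : Type*} [MeasurableSpace Ω] {P : Measure Ω} [IsProbabilityMeasure P]
  {s : ℕ → Ω → S} {a : ℕ → Ω → Fin N → ℕ}

/-- Mean drift of the Lyapunov function over a frame. -/
lemma lintegral_lyapunov_sampled_le {M : ℕ} (hM : net.BoundedBy M) {pol : Rule N S K}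
    (hpol : pol.IsMaxWeight net) (hin : IsIIDInput P π lam s a)
    (ha : ∀ᵐ ω ∂P, ∀ l i, a l ω i ≤ M) {δ : ℝ} (hδ : 0 < δ) (T : ℕ) (z : QState N)
    (hmargin : ∑ i, ((z.X i : ℝ) * lam i - net.unit i * z.U i * net.avgPower i)
      + δ * net.backlog z ≤ ∫ s, net.weight z s (pol.choice z s) ∂π.toMeasure) :
    ∫⁻ ω, ENNReal.ofReal (net.lyapunov (sampled net pol T s a z 1 ω)) ∂P
        + ENNReal.ofReal (2 * T * δ * net.backlog z) ≤
      ENNReal.ofReal (net.lyapunov z) + ENNReal.ofReal (T * net.slack M T) := by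
  -- Since `z` is deterministic, the frozen weight depends on the slot only through its topology, so
  -- every slot of the frame has the same mean drift.
  set W : S → ℝ := fun s => net.weight z s (pol.choice z s) with hW
  set H : Ω → ℝ := fun ω => net.lyapunov z + ∑ l ∈ Finset.range T,
    (2 * (∑ i, ((z.X i : ℝ) * a l ω i - net.unit i * z.U i * net.avgPower i) - W (s l ω))
      + net.slack M T) with hH
  have hle : ∀ᵐ ω ∂P, net.lyapunov (sampled net pol T s a z 1 ω) ≤ H ω := by
    filter_upwards [ha] with ω hω
    have := (lyapunov_frameRun_le hM hpol (s := fun n => s n ω) hω z T le_rfl).2.2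
    simpa only [sampled, one_mul] using this
  have haint : ∀ l i, Integrable (fun ω => (a l ω i : ℝ)) P := fun l i => by
    refine Integrable.of_bound ((Measurable.of_discrete (f := fun x : Fin N → ℕ => (x i : ℝ))).comp
      (hin.measurable_a l)).aestronglyMeasurable M ?_
    filter_upwards [ha] with ω hω
    simpa using hω l i
  have hamean : ∀ l i, ∫ ω, (a l ω i : ℝ) ∂P = lam i := fun l i => by
    have hm : ∀ l, ∫ ω, (a l ω i : ℝ) ∂P = ∫ x, (x i : ℝ) ∂(P.map (a l)) := fun l =>
      (integral_map (hin.measurable_a l).aemeasurable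
        (Measurable.of_discrete (f := fun x : Fin N → ℕ => (x i : ℝ))).aestronglyMeasurable).symm
    rw [hm, hin.law_a, ← hm, hin.mean]
  have hWint : ∀ l, Integrable (fun ω => W (s l ω)) P := fun l =>
    integrable_comp_of_finite (hin.measurable_s l) W
  have hWmean : ∀ l, ∫ ω, W (s l ω) ∂P = ∫ s, W s ∂π.toMeasure := fun l => by
    rw [← hin.law_s l, integral_map (hin.measurable_s l).aemeasurable
      (Measurable.of_discrete (f := W)).aestronglyMeasurable]
  set F : ℕ → Ω → ℝ := fun l ω =>
    ∑ i, ((z.X i : ℝ) * a l ω i - net.unit i * z.U i * net.avgPower i) with hF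
  have hXint : ∀ l i, Integrable (fun ω => (z.X i : ℝ) * a l ω i
      - net.unit i * z.U i * net.avgPower i) P := fun l i =>
    ((haint l i).const_mul _).sub (integrable_const _)
  have hFint : ∀ l, Integrable (F l) P := fun l => integrable_finsetSum _ fun i _ => hXint l i
  have hFmean : ∀ l, ∫ ω, F l ω ∂P =
      ∑ i, ((z.X i : ℝ) * lam i - net.unit i * z.U i * net.avgPower i) := fun l => by
    rw [hF, integral_finsetSum _ fun i _ => hXint l i]
    refine Finset.sum_congr rfl fun i _ => ?_
    rw [integral_sub ((haint l i).const_mul _) (integrable_const _), integral_const_mul, hamean]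
    simp
  have hDint : ∀ l, Integrable (fun ω => F l ω - W (s l ω)) P := fun l =>
    (hFint l).sub (hWint l)
  have hLint : ∀ l, Integrable (fun ω => 2 * (F l ω - W (s l ω)) + net.slack M T) P := fun l =>
    ((hDint l).const_mul 2).add (integrable_const _)
  have hHint : Integrable H P :=
    (integrable_const _).add (integrable_finsetSum _ fun l _ => hLint l)
  have hHmean : ∫ ω, H ω ∂P = net.lyapunov z + T * (2 * (∑ i, ((z.X i : ℝ) * lam i
      - net.unit i * z.U i * net.avgPower i) - ∫ s, W s ∂π.toMeasure) + net.slack M T) := by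
    have hl : ∀ l, ∫ ω, (2 * (F l ω - W (s l ω)) + net.slack M T) ∂P =
        2 * (∑ i, ((z.X i : ℝ) * lam i - net.unit i * z.U i * net.avgPower i)
          - ∫ s, W s ∂π.toMeasure) + net.slack M T := fun l => by
      rw [integral_add ((hDint l).const_mul 2) (integrable_const _), integral_const_mul,
        integral_sub (hFint l) (hWint l), hWmean, hFmean]
      simp
    rw [hH, integral_add (integrable_const _) (integrable_finsetSum _ fun l _ => hLint l),
      integral_finsetSum _ fun l _ => hLint l, Finset.sum_congr rfl fun l _ => hl l]
    simp [mul_add]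
  have hHnonneg : 0 ≤ᵐ[P] H := by
    filter_upwards [hle] with ω hω
    exact (net.lyapunov_nonneg _).trans hω
  have hb := net.backlog_nonneg z
  calc _ ≤ ∫⁻ ω, ENNReal.ofReal (H ω) ∂P + ENNReal.ofReal (2 * T * δ * net.backlog z) := by
        refine add_le_add (lintegral_mono_ae ?_) le_rfl
        exact hle.mono fun ω hω => ENNReal.ofReal_le_ofReal hω
    _ = ENNReal.ofReal (∫ ω, H ω ∂P + 2 * T * δ * net.backlog z) := by
        rw [← ofReal_integral_eq_lintegral_ofReal hHint hHnonneg,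
          ENNReal.ofReal_add (integral_nonneg_of_ae hHnonneg) (by positivity)]
    _ ≤ ENNReal.ofReal (net.lyapunov z + T * net.slack M T) := by
        refine ENNReal.ofReal_le_ofReal ?_
        rw [hHmean]
        have := mul_le_mul_of_nonneg_left hmargin (by positivity : (0 : ℝ) ≤ 2 * T)
        linarith
    _ = _ := ENNReal.ofReal_add (net.lyapunov_nonneg z)
        (mul_nonneg (Nat.cast_nonneg _) (net.slack_nonneg M T))

end Main

end Relay

end

/-! ### Foster's criterion applied to the sampled queues -/

theorem lemma2 {N : ℕ} {S K : Type*} [Finite S] [Finite K]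
    [MeasurableSpace S] [DiscreteMeasurableSpace S]
    [MeasurableSpace K] [DiscreteMeasurableSpace K]
    (net : Relay.Network N S K) (π : PMF S) (lam : Fin N → ℝ)
    (hlam : Relay.Stabilizable net π lam)
    (T : ℕ) (hT : 0 < T)
    (pol : Relay.Rule N S K) (hpol : pol.IsMaxWeight net)
    {Ω : Type*} [MeasurableSpace Ω] (P : Measure Ω) [IsProbabilityMeasure P]
    (s : ℕ → Ω → S) (a : ℕ → Ω → Fin N → ℕ) (hin : Relay.IsIIDInput P π lam s a) :
    -- the sampled process is a Markov chain
    Relay.IsMarkovChain P (Relay.sampled net pol T s a) ∧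
    -- positive recurrence: from every initial state, a state with finite mean return time is
    -- reached in finite mean time
    (∀ z, ∫⁻ ω, Relay.hitTime (fun m => Relay.sampled net pol T s a z m ω)
      {z' | Relay.PosRecState P (Relay.sampled net pol T s a) z'} ∂P < ∞) ∧
    -- on each irreducible class, all states are positive recurrent and there is exactly one
    -- stationary distribution
    (∀ C, Relay.IsIrreducibleClass P (Relay.sampled net pol T s a) C →
      (∀ z ∈ C, Relay.PosRecState P (Relay.sampled net pol T s a) z) ∧
      ∃! ν : PMF (Relay.QState N),
        Relay.IsStationary P (Relay.sampled net pol T s a) ν ∧ ν.support ⊆ C) ∧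
    -- stationary distributions exist, and the mean of each queue is finite under each of them
    (∃ ν : PMF (Relay.QState N), Relay.IsStationary P (Relay.sampled net pol T s a) ν) ∧
    (∀ ν : PMF (Relay.QState N), Relay.IsStationary P (Relay.sampled net pol T s a) ν →
      ∀ i, ∑' q, ν q * (q.X i : ℝ≥0∞) < ∞ ∧ ∑' q, ν q * (q.Y i : ℝ≥0∞) < ∞ ∧
        ∑' q, ν q * ENNReal.ofReal (net.unit i * (q.U i : ℝ)) < ∞) := by
  obtain ⟨δ, Ω', _, P', s', k', own', linkRate, ownRate, relayRate, pow, hδ, hP', hst⟩ := hlam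
  obtain ⟨A, hA⟩ := hin.bounded
  obtain ⟨M, hAM, hM⟩ := net.exists_boundedBy (S := S) (K := K) A
  have ha : ∀ᵐ ω ∂P, ∀ l i, a l ω i ≤ M :=
    ae_all_iff.2 fun l => ae_all_iff.2 fun i => (hA l i).mono fun ω h => h.trans hAM
  have hε : 0 < 2 * T * δ := by positivity
  have hchain := Relay.isAdaptedChain_sampled net pol hT hin
  obtain ⟨h1, h2, h3, h4⟩ := hchain.positive_recurrence
    (V := fun q => ENNReal.ofReal (net.lyapunov q))
    (f := fun q => ENNReal.ofReal (2 * T * δ * net.backlog q))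
    (b := ENNReal.ofReal (T * net.slack M T)) ENNReal.ofReal_ne_top
    (fun _ => ENNReal.ofReal_ne_top)
    (fun z => Relay.lintegral_lyapunov_sampled_le hM hpol hin ha hδ T z
      (hst.margin_le z _ fun s k own => (net.gain_le_weight z s k own).trans ((hpol z s).1 k))) (by
      refine (Relay.finite_backlog_le net ((T * net.slack M T + 1) / (2 * T * δ))).subset
        fun q hq => ?_
      rw [Set.mem_ofPred_eq, ← ENNReal.ofReal_one, ← ENNReal.ofReal_add
        (mul_nonneg (Nat.cast_nonneg _) (net.slack_nonneg M T)) zero_le_one,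
        ENNReal.ofReal_lt_ofReal_iff_of_nonneg (mul_nonneg hε.le (net.backlog_nonneg q))] at hq
      rw [Set.mem_ofPred_eq, le_div_iff₀ hε, mul_comm]
      exact hq.le)
  refine ⟨hchain.isMarkovChain, h1, h2, h3, fun ν hν i => ?_⟩
  -- Each queue is dominated by the backlog, whose mean is finite after dividing the bound on the
  -- mean of `f` by 2Tδ > 0.
  have key : ∀ g : Relay.QState N → ℝ, (∀ q, g q ≤ net.backlog q) →
      ∑' q, ν q * ENNReal.ofReal (g q) < ∞ := by
    intro g hg
    have hε' : ENNReal.ofReal (2 * T * δ) ≠ 0 := (ENNReal.ofReal_pos.2 hε).ne'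
    have hb : ENNReal.ofReal (2 * T * δ) * ∑' q, ν q * ENNReal.ofReal (g q) < ∞ := by
      rw [← ENNReal.tsum_mul_left]
      refine lt_of_le_of_lt (ENNReal.tsum_le_tsum fun q => ?_)
        ((h4 ν hν).trans_lt ENNReal.ofReal_lt_top)
      rw [ENNReal.ofReal_mul hε.le, mul_left_comm]
      gcongr
      exact hg q
    by_contra hcon
    rw [not_lt_top_iff.1 hcon, ENNReal.mul_top hε'] at hb
    exact lt_irrefl _ hb
  obtain ⟨hX, hY, hU⟩ : (∀ q : Relay.QState N, (q.X i : ℝ) ≤ net.backlog q) ∧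
      (∀ q : Relay.QState N, (q.Y i : ℝ) ≤ net.backlog q) ∧
      ∀ q : Relay.QState N, net.unit i * (q.U i : ℝ) ≤ net.backlog q := by
    have hu : ∀ q : Relay.QState N, 0 ≤ net.unit i * (q.U i : ℝ) := fun q =>
      mul_nonneg (net.unit_pos i).le (Nat.cast_nonneg _)
    refine ⟨fun q => ?_, fun q => ?_, fun q => ?_⟩ <;>
      linarith [net.le_backlog q i, hu q, (Nat.cast_nonneg (q.X i) : (0 : ℝ) ≤ _),
        (Nat.cast_nonneg (q.Y i) : (0 : ℝ) ≤ _)]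
  refine ⟨?_, ?_, key _ hU⟩
  · simpa using key _ hX
  · simpa using key _ hY
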